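/- **Setting.** Let $f:\mathbb R^d\to\mathbb R$ be differentiable with $L$-Lipschitz gradient ($L>0$), let $g:\mathbb R^d\to(-\infty,+\infty]$ be proper, convex and lower semicontinuous, and put $F=f+g$. Assume that $\inf F>-\infty$ and that every level set $\{x:F(x)\le a\}$, $a\in\mathbb R$, is compact. For $h:\mathbb R^d\to(-\infty,+\infty]$ and $x\in\operatorname{dom}h=\{h<\infty\}$, the Fréchet subdifferential is $$\widehat\partial h(x)=\Big\{u:\liminf_{z\to x,\,z\ne x}\frac{h(z)-h(x)-u^\top(z-x)}{\|z-x\|}\ge0\Big\},$$ and the limiting subdifferential $\partial h(x)$ is the set of limits of sequences $u_k\in\widehat\partial h(x_k)$ with $x_k\to x$ and $h(x_k)\to h(x)$; both are empty for $x\notin\operatorname{dom}h$. The set of critical points is $\operatorname{crit}h=\{x:0\in\partial h(x)\}$. Distances to sets take values in $[0,\infty]$, with $\operatorname{dist}_\emptyset=+\infty$. Assume also that $F$ has the Kurdyka–Łojasiewicz property: for every compact $\Omega\subset\operatorname{dom}F$ on which $F$ is constant, equal to $F_\Omega$, there are $\varepsilon,\lambda,c>0$ and $\theta\in(0,1]$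 such that, with $\varphi(s)=\frac c\theta s^\theta$, $$\varphi'(F(x)-F_\Omega)\,\operatorname{dist}_{\partial F(x)}(0)\ge1\quad\text{whenever }\operatorname{dist}_\Omega(x)<\varepsilon\text{ and }F_\Omega<F(x)<F_\Omega+\lambda .$$ **Algorithm.** For $\eta>0$ let $\operatorname{prox}_{\eta g}(x)$ be the unique minimizer of $z\mapsto g(z)+\frac1{2\eta}\|z-x\|^2$, and let $G_\eta(x,u)=\frac1\eta\big(x-\operatorname{prox}_{\eta g}(x-\eta u)\big)$. Let $q_0=0$, let $q_1,q_2,\dots\ge1$ be arbitrary integers, and put $Q_t=\sum_{\ell=0}^tq_\ell$ and $\alpha_k=\frac2{k-Q_t+2}$, where $t$ is the largest integer with $Q_t\le k$. Let $\beta_k=\frac1{8L}$ and let $\lambda_k\in[\beta_k,(1+\alpha_{k+1})\beta_k]$ be arbitrary. Start from an arbitrary $x_0=y_0\in\mathbb R^d$ and iterate, for $k=0,1,2,\dots$, $$z_k=(1-\alpha_{k+1})y_k+\alpha_{k+1}x_k,\quad x_{k+1}=x_k-\lambda_kG_{\lambda_k}(x_k,\nabla f(z_k)),\quad y_{k+1}=z_k-\beta_kG_{\lambda_k}(x_k,\nabla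 f(z_k)).$$ Whenever $k+1=Q_t$ for some $t$, the values $x_{k+1},y_{k+1}$ just computed are then replaced, according to one of two rules that is fixed throughout the run: * rule (a): both are reset to the newly computed $x_{k+1}$; * rule (b): both are reset to $x_k$. With this rule a period of length $1$ does not move the iterate, so for rule (b) it is assumed that $q_t\ge2$ for infinitely many $t$. **Theorem.** For either rule, the sequences $(x_k),(y_k),(z_k)$ so generated (after the resets) satisfy the following. The per-period path lengths $L_t=\big(\sum_{k=Q_t}^{Q_{t+1}-1}\|x_{k+1}-x_k\|^2\big)^{1/2}$ are summable, $\sum_{t=0}^\infty L_t<\infty$, and there is a critical point $x^*\in\operatorname{crit}F$ such that $x_k\to x^*$, $y_k\to x^*$ and $z_k\to x^*$. -/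

import Mathlib

open Filter Topology
open scoped Gradient

namespace APGRestart

noncomputable section

/-! ## Subdifferentials, critical points and the Kurdyka-Lojasiewicz property

Functions `h : ℝ^d → (-∞, +∞]` are modelled as `EReal`-valued functions; `dom h` is the set of
points where `h` is finite. -/

/-- `ℝ^d` with the Euclidean norm. -/
abbrev Euc (d : ℕ) := EuclideanSpace ℝ (Fin d)

/-- A proper function: it never takes the value `-∞` and it is finite somewhere. -/
def IsProper {d : ℕ} (h : Euc d → EReal) : Prop :=
  (∀ x, h x ≠ ⊥) ∧ ∃ x, h x ≠ ⊤

/-- Convexity of an extended-real-valued function: its epigraph is convex. -/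
def IsConvexFun {d : ℕ} (h : Euc d → EReal) : Prop :=
  Convex ℝ {p : Euc d × ℝ | h p.1 ≤ (p.2 : EReal)}

/-- The Frechet subdifferential of `h` at `x` (empty when `x ∉ dom h`). -/
def frechetSubdiff {d : ℕ} (h : Euc d → EReal) (x : Euc d) : Set (Euc d) :=
  {u | h x ≠ ⊥ ∧ h x ≠ ⊤ ∧
    0 ≤ liminf (fun z => (h z - h x - ((inner ℝ u (z - x) : ℝ) : EReal)) / ((‖z - x‖ : ℝ) : EReal))
      (𝓝[≠] x)}

/-- The limiting subdifferential of `h` at `x` (empty when `x ∉ dom h`). -/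
def limitingSubdiff {d : ℕ} (h : Euc d → EReal) (x : Euc d) : Set (Euc d) :=
  {u | h x ≠ ⊥ ∧ h x ≠ ⊤ ∧ ∃ (xs us : ℕ → Euc d),
    Tendsto xs atTop (𝓝 x) ∧ Tendsto (fun n => h (xs n)) atTop (𝓝 (h x)) ∧
    (∀ n, us n ∈ frechetSubdiff h (xs n)) ∧ Tendsto us atTop (𝓝 u)}

/-- The set of critical points of `h`. -/
def crit {d : ℕ} (h : Euc d → EReal) : Set (Euc d) :=
  {x | (0 : Euc d) ∈ limitingSubdiff h x}

/-- The desingularizing function `φ(s) = (c / θ) s ^ θ`. -/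
def desing (c θ : ℝ) (s : ℝ) : ℝ := c / θ * s ^ θ

/-- The Kurdyka-Lojasiewicz property. Distances to sets are `[0, ∞]`-valued, so the distance to the
empty set is `+∞`. -/
def HasKL {d : ℕ} (h : Euc d → EReal) : Prop :=
  ∀ (Ω : Set (Euc d)) (hΩ : ℝ), IsCompact Ω → (∀ x ∈ Ω, h x = (hΩ : EReal)) →
    ∃ ε > (0 : ℝ), ∃ lam > (0 : ℝ), ∃ c > (0 : ℝ), ∃ θ ∈ Set.Ioc (0 : ℝ) 1,
      ∀ x : Euc d, Metric.infEDist x Ω < ENNReal.ofReal ε →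
        (hΩ : EReal) < h x → h x < ((hΩ + lam : ℝ) : EReal) →
          1 ≤ ENNReal.ofReal (deriv (desing c θ) ((h x).toReal - hΩ)) *
                Metric.infEDist (0 : Euc d) (limitingSubdiff h x)

/-! ## Proximal map and gradient mapping -/

/-- The set of minimizers of `z ↦ h z + ‖z - x‖² / (2 η)`. -/
def proxSet {d : ℕ} (η : ℝ) (h : Euc d → EReal) (x : Euc d) : Set (Euc d) :=
  {p | ∀ z, h p + ((1 / (2 * η) * ‖p - x‖ ^ 2 : ℝ) : EReal) ≤
            h z + ((1 / (2 * η) * ‖z - x‖ ^ 2 : ℝ) : EReal)}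

/-- The proximal map: the element of `proxSet η h x`, which is unique and exists when `η > 0` and
`h` is proper, convex and lower semicontinuous. -/
def prox {d : ℕ} (η : ℝ) (h : Euc d → EReal) (x : Euc d) : Euc d :=
  Classical.epsilon (fun p => p ∈ proxSet η h x)

/-- The gradient mapping `G_η(x, u) = (x - prox_{η g}(x - η u)) / η`. -/
def gradMap {d : ℕ} (g : Euc d → EReal) (η : ℝ) (x u : Euc d) : Euc d :=
  (1 / η) • (x - prox η g (x - η • u))

/-! ## The algorithm -/

/-- The objective `F = f + g`. -/
def objective {d : ℕ} (f : Euc d → ℝ) (g : Euc d → EReal) (x : Euc d) : EReal :=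
  ((f x : ℝ) : EReal) + g x

/-- Restart checkpoints `Q_t = q_0 + ... + q_t`. -/
def checkpoint (q : ℕ → ℕ) (t : ℕ) : ℕ := ∑ l ∈ Finset.range (t + 1), q l

/-- The largest `t` with `Q_t ≤ k`. (If `q_0 = 0` and `q_t ≥ 1` for `t ≥ 1`, then `Q_t ≥ t`, so
that the search can stop at `t = k`.) -/
def periodIndex (q : ℕ → ℕ) (k : ℕ) : ℕ :=
  Nat.findGreatest (fun t => checkpoint q t ≤ k) k

/-- The momentum coefficient `α_k = 2 / (k - Q_t + 2)`, where `t` is the largest integer with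
`Q_t ≤ k`. -/
def momentum (q : ℕ → ℕ) (k : ℕ) : ℝ :=
  2 / ((k : ℝ) - (checkpoint q (periodIndex q k) : ℝ) + 2)

/-- The point to which `x_k` and `y_k` are both reset at a restart time `k`:
`previous` is the iterate `x_{k-1}` (the `x_k` just computed is discarded), `latest` is the `x_k`
that iteration `k - 1` has just computed (only the momentum is discarded). -/
inductive ResetRule
  | previous
  | latest

/-- The point chosen by a reset rule, from `x_{k-1}` and the freshly computed `x_k`. -/
def ResetRule.point {d : ℕ} (rule : ResetRule) (xprev xnew : Euc d) : Euc d :=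
  match rule with
  | .previous => xprev
  | .latest => xnew

/-- `z_k = (1 - α_{k+1}) y_k + α_{k+1} x_k`, for given `s = (x_k, y_k)`. -/
def extrapolate {d : ℕ} (q : ℕ → ℕ) (k : ℕ) (s : Euc d × Euc d) : Euc d :=
  (1 - momentum q (k + 1)) • s.2 + momentum q (k + 1) • s.1

open Classical in
/-- The pair `(x_k, y_k)` of the algorithm (after the reset, if `k` is a restart time), with initial
point `xinit` and step sizes `lam`, `β`. -/
def state {d : ℕ} (rule : ResetRule) (f : Euc d → ℝ) (g : Euc d → EReal) (q : ℕ → ℕ)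
    (lam β : ℕ → ℝ) (xinit : Euc d) : ℕ → Euc d × Euc d
  | 0 => (xinit, xinit)
  | k + 1 =>
    let s := state rule f g q lam β xinit k
    let z := extrapolate q k s
    let G := gradMap g (lam k) s.1 (∇ f z)
    let xnew := s.1 - lam k • G
    let ynew := z - β k • G
    if ∃ t, checkpoint q t = k + 1 then (rule.point s.1 xnew, rule.point s.1 xnew)
    else (xnew, ynew)

/-- The sequence `x_k`. -/
def xSeq {d : ℕ} (rule : ResetRule) (f : Euc d → ℝ) (g : Euc d → EReal) (q : ℕ → ℕ)
    (lam β : ℕ → ℝ) (xinit : Euc d) (k : ℕ) : Euc d :=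
  (state rule f g q lam β xinit k).1

/-- The sequence `y_k`. -/
def ySeq {d : ℕ} (rule : ResetRule) (f : Euc d → ℝ) (g : Euc d → EReal) (q : ℕ → ℕ)
    (lam β : ℕ → ℝ) (xinit : Euc d) (k : ℕ) : Euc d :=
  (state rule f g q lam β xinit k).2

/-- The sequence `z_k`. -/
def zSeq {d : ℕ} (rule : ResetRule) (f : Euc d → ℝ) (g : Euc d → EReal) (q : ℕ → ℕ)
    (lam β : ℕ → ℝ) (xinit : Euc d) (k : ℕ) : Euc d :=
  extrapolate q k (state rule f g q lam β xinit k)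

/-- The path length `L_t` of the restart period from `Q_t` to `Q_{t+1}`, for a sequence `x`. -/
def pathLength {d : ℕ} (q : ℕ → ℕ) (x : ℕ → Euc d) (t : ℕ) : ℝ :=
  Real.sqrt (∑ k ∈ Finset.Ico (checkpoint q t) (checkpoint q (t + 1)), ‖x (k + 1) - x k‖ ^ 2)

end

end APGRestart

namespace APGRestart

/-! ## A Lyapunov inequality for real sequences -/

/-! Write D_k = ‖y_k - x_k‖, δ_k = ‖x_{k+1} - x_k‖, and let w_k be the position of k in its period,
counted from 1. The gradient is taken at z_k and not at x_k, so F(x_k) need not decrease. The energy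
F(x_k)/L + w_k D_k²/8 does, by at least (D_k² + δ_k²)/64 (`energy_succ_le`, `energyDrop_ge`). Since
D_k = 0 at every restart, w_k D_k² → 0, so F(x_k) converges, and F takes the limit value at every
cluster point (`objective_eq_of_clusterPt`).

Let H be the energy minus its limit. The usual KL argument needs a power of H to be bounded by the
last step, but w_k is unbounded, so the kinetic term w D²/8 is not controlled in this way. There are
two regimes. If the objective gap is the larger part, KL gives H^(1-θ) ≤ C · (last step). Otherwise
H ≤ (9/64) w D². The Lyapunov function `lyap` serves both. Its term (w+1)D changes by at most 2δ -
D. The root of w H falls with the energy, which pays for 2δ, while the growth of w costs it only a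
fraction of D. The multiple of H^θ is the classical desingularized gap, and the summand H^(2θ) under
the root keeps the growth of w cheap in the KL regime. Telescoping `lyap_step` bounds Σ (D_k + δ_k)
whatever the period lengths are (`summable_of_energy_of_KL`).

Hence x_k is Cauchy and D_k → 0. Each proximal step yields a subgradient of F of norm at most 9L
times the step size, so the limit is critical. When a reset undoes a step, the point has not moved,
and the last step that was kept still supplies the subgradient. -/

theorem sqrt_le_tangent {a b : ℝ} (ha : 0 < a) (hb : 0 ≤ b) :
    √b ≤ √a + (b - a) / (2 * √a) := by
  have h := Real.sqrt_pos.2 ha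
  rw [← sub_le_iff_le_add', le_div_iff₀ (by positivity)]
  nlinarith [sq_nonneg (√b - √a), Real.sq_sqrt ha.le, Real.sq_sqrt hb]

theorem rpow_le_tangent {a b θ : ℝ} (ha : 0 < a) (hb : 0 ≤ b) (hθ : 0 ≤ θ) (hθ1 : θ ≤ 1) :
    b ^ θ ≤ a ^ θ - θ * a ^ (θ - 1) * (a - b) := by
  have h1 : (b / a) ^ θ ≤ 1 + θ * (b / a - 1) := by
    have := rpow_one_add_le_one_add_mul_self (s := b / a - 1)
      (by linarith [div_nonneg hb ha.le]) hθ hθ1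
    simpa using this
  rw [Real.div_rpow hb ha.le, div_le_iff₀ (by positivity)] at h1
  refine h1.trans (le_of_eq ?_)
  rw [Real.rpow_sub_one ha.ne']
  field_simp
  ring

/-- The decrease of the energy `F / L + w D² / 8` in one step. -/
noncomputable def energyDrop (r D δ : ℝ) : ℝ := r * D ^ 2 / 8 - r * D * δ + 11 / 4 * δ ^ 2

/-- Both sides are quadratic forms in (D, δ), affine in r, so only r = 1/3 and r = 1 matter; the
squares in the certificate are weighted by r - 1/3 and 1 - r. The next two inequalities are of the
same kind. -/
theorem energyDrop_ge {r D δ : ℝ} (hr : 1 / 3 ≤ r) (hr1 : r ≤ 1) :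
    (D ^ 2 + δ ^ 2) / 64 ≤ energyDrop r D δ := by
  unfold energyDrop
  nlinarith [mul_nonneg (sub_nonneg.2 hr) (sq_nonneg (7 * D - 32 * δ)), mul_nonneg
    (sub_nonneg.2 hr1) (sq_nonneg (D - 5 * δ)),
    mul_nonneg (sub_nonneg.2 hr) (sq_nonneg δ), mul_nonneg (sub_nonneg.2 hr1) (sq_nonneg δ),
    mul_nonneg (sub_nonneg.2 hr) (sq_nonneg D), mul_nonneg (sub_nonneg.2 hr1) (sq_nonneg D)]

/-- This and the next inequality are the step estimate in the kinetic regime, multiplied by D, at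
the extreme value H = (9/64) w D². The coefficients 3 and 3/2 come from bounding the root from below
and from above. -/
theorem energyDrop_three {r D δ : ℝ} (hr : 1 / 3 ≤ r) (hr1 : r ≤ 1) :
    (2 * δ - D + (D + δ) / 16) * D + 27 / 64 * D ^ 2 - 3 * energyDrop r D δ ≤ 0 := by
  unfold energyDrop
  nlinarith [mul_nonneg (sub_nonneg.2 hr) (sq_nonneg (5 * D - 16 * δ)), mul_nonneg
    (sub_nonneg.2 hr1) (sq_nonneg (D - 3 * δ)),
    mul_nonneg (sub_nonneg.2 hr) (sq_nonneg δ), mul_nonneg (sub_nonneg.2 hr1) (sq_nonneg δ),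
    mul_nonneg (sub_nonneg.2 hr) (sq_nonneg D), mul_nonneg (sub_nonneg.2 hr1) (sq_nonneg D)]

theorem energyDrop_three_halves {r D δ : ℝ} (hr : 1 / 3 ≤ r) (hr1 : r ≤ 1) :
    (2 * δ - D + (D + δ) / 16) * D + 27 / 128 * D ^ 2 - 3 / 2 * energyDrop r D δ ≤ 0 := by
  unfold energyDrop
  nlinarith [mul_nonneg (sub_nonneg.2 hr) (sq_nonneg (7 * D - 15 * δ)), mul_nonneg
    (sub_nonneg.2 hr1) (sq_nonneg (D - 2 * δ)),
    mul_nonneg (sub_nonneg.2 hr) (sq_nonneg δ), mul_nonneg (sub_nonneg.2 hr1) (sq_nonneg δ),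
    mul_nonneg (sub_nonneg.2 hr) (sq_nonneg D), mul_nonneg (sub_nonneg.2 hr1) (sq_nonneg D)]

/-- The Lyapunov function; `θ` and `C` are the exponent and the constant of a
Kurdyka-Lojasiewicz inequality. -/
noncomputable def lyap (θ C w D H : ℝ) : ℝ :=
  (w + 1) * D + 9 / 4 * √(w * H + (72 * C) ^ 2 * H ^ (2 * θ)) + 9000 * C / θ * H ^ θ

theorem lyap_nonneg {θ C w D H : ℝ} (hθ : 0 < θ) (hC : 0 < C) (hw : 1 ≤ w) (hD : 0 ≤ D)
    (hH : 0 ≤ H) : 0 ≤ lyap θ C w D H := by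
  unfold lyap; positivity

/-- For a reset that undoes a step: the momentum vanishes and the whole term (w + 1)D is gained. -/
theorem lyap_mono {θ C w w' D H H' : ℝ} (hθ : 0 < θ) (hC : 0 < C) (hw0 : 1 ≤ w) (hw : w' ≤ w)
    (hH : 0 ≤ H') (hHH : H' ≤ H) :
    lyap θ C w' 0 H' + D ≤ lyap θ C w D H + (D - (w + 1) * D) := by
  unfold lyap
  have h1 : H' ^ (2 * θ) ≤ H ^ (2 * θ) := Real.rpow_le_rpow hH hHH (by positivity)
  have h2 : H' ^ θ ≤ H ^ θ := Real.rpow_le_rpow hH hHH (by positivity)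
  have h3 : √(w' * H' + (72 * C) ^ 2 * H' ^ (2 * θ)) ≤ √(w * H + (72 * C) ^ 2 * H ^ (2 * θ)) := by
    apply Real.sqrt_le_sqrt
    have : 0 ≤ w := by linarith
    gcongr
  have h4 : 9000 * C / θ * H' ^ θ ≤ 9000 * C / θ * H ^ θ := by gcongr
  linarith

/-- Kinetic regime in which w H dominates under the root: the square root alone pays for 2δ. -/
theorem lyap_step_of_momentum_sqrt {θ C w D δ r H A Q M : ℝ} (hC : 0 < C)
    (hw : 1 ≤ w) (hD : 0 ≤ D) (hH : 0 < H) (hM : 0 ≤ M)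
    (hA : A = w * H + (72 * C) ^ 2 * H ^ (2 * θ)) (hQ0 : 0 ≤ Q) (hr : 1 / 3 ≤ r) (hr1 : r ≤ 1)
    (hQ : Q = energyDrop r D δ) (hKL : H ≤ 9 / 64 * (w * D ^ 2))
    (hc : (72 * C) ^ 2 * H ^ (2 * θ) ≤ 3 * (w * H)) :
    2 * δ - D + (D + δ) / 16 + 9 / 4 * ((H - w * Q) / (2 * √A)) - 9000 * C * H ^ (θ - 1) * Q
      ≤ M / 32 := by
  have hwH : 0 < w * H := by positivity
  have hApos : 0 < A := by rw [hA]; positivity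
  have hsA : 0 < √A := Real.sqrt_pos.2 hApos
  have hHθ : 0 < H ^ (θ - 1) := by positivity
  -- With H = w s² the weight cancels: √(wH) = w s, and the kinetic bound on H reads s ≤ 3D/8.
  obtain ⟨s, hs, hsH⟩ : ∃ s, 0 < s ∧ H = w * s ^ 2 :=
    ⟨√(H / w), by positivity, by rw [Real.sq_sqrt (by positivity)]; field_simp⟩
  have hsD : s ≤ 3 / 8 * D := by
    have : s ^ 2 ≤ (3 / 8 * D) ^ 2 := by
      rw [hsH] at hKL
      have h1 : w * s ^ 2 ≤ w * (3 / 8 * D) ^ 2 := by linarith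
      exact le_of_mul_le_mul_left h1 (by linarith)
    exact abs_le_of_sq_le_sq' this (by positivity) |>.2
  have hDpos : 0 < D := by linarith
  have hws : √(w * H) = w * s := by
    rw [hsH, show w * (w * s ^ 2) = (w * s) ^ 2 by ring, Real.sqrt_sq (by positivity)]
  have hΨ1 : w * s ≤ √A := by
    rw [← hws]
    apply Real.sqrt_le_sqrt
    rw [hA]
    linarith [show 0 ≤ (72 * C) ^ 2 * H ^ (2 * θ) by positivity]
  have hΨ2 : √A ≤ 2 * (w * s) := by
    rw [← hws, show (2 : ℝ) * √(w * H) = √(4 * (w * H)) by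
      rw [Real.sqrt_mul (by norm_num : (0 : ℝ) ≤ 4), show (4 : ℝ) = 2 ^ 2 by norm_num,
        Real.sqrt_sq (by norm_num : (0 : ℝ) ≤ 2)]]
    apply Real.sqrt_le_sqrt; rw [hA]; linarith
  have hneg : 0 ≤ 9000 * C * H ^ (θ - 1) * Q := by positivity
  -- The map s ↦ s - Q/s is increasing, so s = 3D/8 is the worst case.
  have hsq : (s ^ 2 - Q) / s ≤ ((3 / 8 * D) ^ 2 - Q) / (3 / 8 * D) := by
    rw [div_le_div_iff₀ hs (by positivity)]
    nlinarith [mul_nonneg (sub_nonneg.2 hsD) hQ0, mul_nonneg (mul_nonneg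
      (sub_nonneg.2 hsD) hs.le) hDpos.le]
  have hnum : H - w * Q = w * (s ^ 2 - Q) := by rw [hsH]; ring
  -- The sign of the numerator decides whether √A ≥ w s or √A ≤ 2 w s is the useful bound.
  rcases le_total 0 (s ^ 2 - Q) with h | h
  · have h1 : (H - w * Q) / (2 * √A) ≤ (s ^ 2 - Q) / s / 2 := by
      rw [hnum]
      calc _ ≤ w * (s ^ 2 - Q) / (2 * (w * s)) := by gcongr
        _ = _ := by field_simp
    have h3 := energyDrop_three (D := D) (δ := δ) hr hr1
    have h4 : 2 * δ - D + (D + δ) / 16 + 9 / 4 * (((3 / 8 * D) ^ 2 - Q) / (3 / 8 * D) / 2) ≤ 0 := by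
      rw [← hQ] at h3
      have : 2 * δ - D + (D + δ) / 16 + 9 / 4 * (((3 / 8 * D) ^ 2 - Q) / (3 / 8 * D) / 2)
        = ((2 * δ - D + (D + δ) / 16) * D + 27 / 64 * D ^ 2 - 3 * Q) / D := by
        field_simp; ring
      rw [this]
      exact div_nonpos_of_nonpos_of_nonneg h3 hDpos.le
    linarith
  · have h1 : (H - w * Q) / (2 * √A) ≤ (s ^ 2 - Q) / s / 4 := by
      rw [hnum]
      have : w * (Q - s ^ 2) / (2 * (2 * (w * s))) ≤ w * (Q - s ^ 2) / (2 * √A) := by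
        have : 0 ≤ Q - s ^ 2 := by linarith
        gcongr
      have e1 : w * (Q - s ^ 2) / (2 * (2 * (w * s))) = -((s ^ 2 - Q) / s / 4) := by
        field_simp; ring
      have e2 : w * (Q - s ^ 2) / (2 * √A) = -(w * (s ^ 2 - Q) / (2 * √A)) := by ring
      linarith
    have h3 := energyDrop_three_halves (D := D) (δ := δ) hr hr1
    have h4 : 2 * δ - D + (D + δ) / 16 + 9 / 4 * (((3 / 8 * D) ^ 2 - Q) / (3 / 8 * D) / 4) ≤ 0 := by
      rw [← hQ] at h3
      have : 2 * δ - D + (D + δ) / 16 + 9 / 4 * (((3 / 8 * D) ^ 2 - Q) / (3 / 8 * D) / 4)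
        = ((2 * δ - D + (D + δ) / 16) * D + 27 / 128 * D ^ 2 - 3 / 2 * Q) / D := by
        field_simp; ring
      rw [this]
      exact div_nonpos_of_nonpos_of_nonneg h3 hDpos.le
    linarith

/-- Kinetic regime in which the power of H dominates under the root. Then C H^(θ-1) D is bounded
below, so the decrease of the H^θ term is at least linear in D + δ. -/
theorem lyap_step_of_momentum_rpow {θ C w D δ H A Q M : ℝ} (hC : 0 < C)
    (hw : 1 ≤ w) (hD : 0 ≤ D) (hδ : 0 ≤ δ) (hH : 0 < H) (hM : 0 ≤ M)
    (hA : A = w * H + (72 * C) ^ 2 * H ^ (2 * θ)) (hQ0 : 0 ≤ Q)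
    (hb2 : (D + δ) ^ 2 / 128 ≤ Q) (hKL : H ≤ 9 / 64 * (w * D ^ 2))
    (hc : 3 * (w * H) < (72 * C) ^ 2 * H ^ (2 * θ)) :
    2 * δ - D + (D + δ) / 16 + 9 / 4 * ((H - w * Q) / (2 * √A)) - 9000 * C * H ^ (θ - 1) * Q
      ≤ M / 32 := by
  have hwH : 0 < w * H := by positivity
  have hApos : 0 < A := by rw [hA]; positivity
  have hsA : 0 < √A := Real.sqrt_pos.2 hApos
  have hHθ : 0 < H ^ (θ - 1) := by positivity
  obtain ⟨s, hs, hsH⟩ : ∃ s, 0 < s ∧ H = w * s ^ 2 :=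
    ⟨√(H / w), by positivity, by rw [Real.sq_sqrt (by positivity)]; field_simp⟩
  have hsD : s ≤ 3 / 8 * D := by
    have : s ^ 2 ≤ (3 / 8 * D) ^ 2 := by
      rw [hsH] at hKL
      have h1 : w * s ^ 2 ≤ w * (3 / 8 * D) ^ 2 := by linarith
      exact le_of_mul_le_mul_left h1 (by linarith)
    exact abs_le_of_sq_le_sq' this (by positivity) |>.2
  have hDpos : 0 < D := by linarith
  have hws : √(w * H) = w * s := by
    rw [hsH, show w * (w * s ^ 2) = (w * s) ^ 2 by ring, Real.sqrt_sq (by positivity)]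
  have hΨ1 : w * s ≤ √A := by
    rw [← hws]
    apply Real.sqrt_le_sqrt
    rw [hA]
    linarith [show 0 ≤ (72 * C) ^ 2 * H ^ (2 * θ) by positivity]
  have h1 : (H - w * Q) / (2 * √A) ≤ s / 2 := by
    have : 0 ≤ w * Q := by positivity
    calc _ ≤ H / (2 * (w * s)) := by gcongr; linarith
      _ = _ := by rw [hsH]; field_simp
  have h2 : 4 ≤ 72 * C * H ^ (θ - 1) * D := by
    have e : H ^ (2 * θ) = (H ^ (θ - 1)) ^ 2 * H ^ 2 := by
      rw [← Real.rpow_natCast, ← Real.rpow_natCast, ← Real.rpow_mul hH.le, ← Real.rpow_add hH]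
      congr 1; push_cast; ring
    rw [e] at hc
    have h3 : 3 * w < (72 * C * H ^ (θ - 1)) ^ 2 * H := by
      have : (3 * w) * H < ((72 * C * H ^ (θ - 1)) ^ 2 * H) * H := by nlinarith
      exact lt_of_mul_lt_mul_right this hH.le
    have h4 : (72 * C * H ^ (θ - 1)) ^ 2 * H ≤ (72 * C * H ^ (θ - 1)) ^ 2 * (9 / 64 *
      (w * D ^ 2)) := by
      gcongr
    have h5 : 3 < (72 * C * H ^ (θ - 1)) ^ 2 * (9 / 64 * D ^ 2) := by
      have : 3 * w < ((72 * C * H ^ (θ - 1)) ^ 2 * (9 / 64 * D ^ 2)) * w := by nlinarith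
      exact lt_of_mul_lt_mul_right this (by linarith)
    have h6 : (4 : ℝ) ^ 2 ≤ (72 * C * H ^ (θ - 1) * D) ^ 2 := by nlinarith
    exact abs_le_of_sq_le_sq' h6 (by positivity) |>.2
  have h3 : (9000 * C * H ^ (θ - 1)) * ((D + δ) ^ 2 / 128) ≤ 9000 * C * H ^ (θ - 1) * Q := by gcongr
  have h4 : 4 * (D + δ) ≤ 72 * C * H ^ (θ - 1) * (D + δ) ^ 2 := by
    have : 72 * C * H ^ (θ - 1) * D ≤ 72 * C * H ^ (θ - 1) * (D + δ) := by gcongr; linarith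
    nlinarith
  nlinarith

/-- The classical KL step. Half of M/32 pays for the growth of w under the root, the other half
enters an arithmetic-geometric mean estimate. -/
theorem lyap_step_of_KL {θ C w D δ H A Q M : ℝ} (hC : 0 < C) (hw : 1 ≤ w)
    (hD : 0 ≤ D) (hH : 0 < H) (hM : 0 ≤ M)
    (hA : A = w * H + (72 * C) ^ 2 * H ^ (2 * θ)) (hQ0 : 0 ≤ Q)
    (hb2 : (D + δ) ^ 2 / 128 ≤ Q) (hKL : H ^ (1 - θ) ≤ C * M) :
    2 * δ - D + (D + δ) / 16 + 9 / 4 * ((H - w * Q) / (2 * √A)) - 9000 * C * H ^ (θ - 1) * Q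
      ≤ M / 32 := by
  have hwH : 0 < w * H := by positivity
  have hApos : 0 < A := by rw [hA]; positivity
  have hsA : 0 < √A := Real.sqrt_pos.2 hApos
  have hHθ : 0 < H ^ (θ - 1) := by positivity
  have e1 : H ^ (θ - 1) * H ^ (1 - θ) = 1 := by
    rw [← Real.rpow_add hH]; simp
  have hMpos : 0 < M := by
    have : 0 < H ^ (1 - θ) := by positivity
    by_contra h
    have : M = 0 := by linarith
    subst this; linarith
  have h1 : 1 ≤ H ^ (θ - 1) * (C * M) :=
      e1.symm.le.trans (mul_le_mul_of_nonneg_left hKL hHθ.le)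
  -- The summand (72C)² H^(2θ) gives √A ≥ 72 C H^θ, while KL gives H ≤ C H^θ M. After the factor 9/4
  -- the cost is M/64.
  have h2 : (H - w * Q) / (2 * √A) ≤ M / 144 := by
    have h3 : 72 * C * H ^ θ ≤ √A := by
      apply Real.le_sqrt_of_sq_le
      rw [hA, mul_pow, ← Real.rpow_natCast (H ^ θ), ← Real.rpow_mul hH.le]
      have : θ * ((2 : ℕ) : ℝ) = 2 * θ := by push_cast; ring
      rw [this]; linarith
    have h4 : H = H ^ θ * H ^ (1 - θ) := by rw [← Real.rpow_add hH]; simp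
    have h5 : H ≤ H ^ θ * (C * M) := by
      calc H = H ^ θ * H ^ (1 - θ) := h4
        _ ≤ _ := by gcongr
    have h6 : 0 ≤ w * Q := by positivity
    rw [div_le_iff₀ (by positivity)]
    nlinarith
  have h3 : (9000 * C * H ^ (θ - 1)) * ((D + δ) ^ 2 / 128) ≤ 9000 * C * H ^ (θ - 1) * Q := by gcongr
  have h4 : (D + δ) ^ 2 ≤ H ^ (θ - 1) * C * (D + δ) ^ 2 * M := by
    nlinarith [sq_nonneg (D + δ)]
  set X := H ^ (θ - 1) * C * (D + δ) ^ 2 with hX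
  -- The factor 33/16 = 2 + 1/16 dominates the coefficients of D and δ. Since (D + δ)² ≤ X M, this
  -- is the arithmetic-geometric mean inequality for X and M.
  have h5 : 33 / 16 * (D + δ) ≤ 70 * X + M / 64 := by
    have : 33 / 16 * (D + δ) * M ≤ 70 * (D + δ) ^ 2 + M / 64 * M := by
      nlinarith [sq_nonneg (33 * (D + δ) - M / 2)]
    have : 33 / 16 * (D + δ) * M ≤ (70 * X + M / 64) * M := by linarith
    exact le_of_mul_le_mul_right this hMpos
  have h6 : 70 * X ≤ (9000 * C * H ^ (θ - 1)) * ((D + δ) ^ 2 / 128) := by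
    have : 0 ≤ X := by positivity
    rw [hX] at this ⊢; nlinarith
  linarith

/-- One step of the Lyapunov inequality. -/
theorem lyap_step {θ C w w' D D' δ r H H' M : ℝ} (hθ : 0 < θ) (hθ1 : θ ≤ 1 / 2) (hC : 0 < C)
    (hw : 1 ≤ w) (hw' : w' ≤ w + 1) (hD : 0 ≤ D) (hδ : 0 ≤ δ) (hr : 1 / 3 ≤ r) (hr1 : r ≤ 1)
    (hM : 0 ≤ M) (hw1 : 1 ≤ w') (hD0 : 0 ≤ D')
    (hD' : (w' + 1) * D' ≤ w * D + 2 * δ) (hH' : 0 ≤ H') (hHH : H' ≤ H - energyDrop r D δ)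
    (hKL : H ≤ 9 / 64 * (w * D ^ 2) ∨ H ^ (1 - θ) ≤ C * M) :
    lyap θ C w' D' H' + (D + δ) / 16 ≤ lyap θ C w D H + M / 32 := by
  have hq := energyDrop_ge (D := D) (δ := δ) hr hr1
  set Q := energyDrop r D δ with hQ
  have hQ0 : 0 ≤ Q := le_trans (by positivity) hq
  have hH : 0 ≤ H := by linarith
  have hb2 : (D + δ) ^ 2 / 128 ≤ Q := by nlinarith [sq_nonneg (D - δ)]
  -- The tangent bounds need H > 0. If H = 0, the energy cannot drop, and all quantities vanish.
  rcases hH.eq_or_lt with hH0 | hHpos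
  · have hQ1 : Q = 0 := by linarith
    have hD1 : D = 0 := by nlinarith [sq_nonneg D, sq_nonneg δ]
    have hδ1 : δ = 0 := by nlinarith [sq_nonneg D, sq_nonneg δ]
    have hH1 : H' = 0 := by linarith
    have hD2 : D' = 0 := by subst hD1 hδ1; nlinarith
    subst hD1 hδ1 hD2
    rw [hH1, ← hH0]
    have : (2 * θ) ≠ 0 := by positivity
    simp [lyap, Real.zero_rpow hθ.ne', Real.zero_rpow this]
    positivity
  set A := w * H + (72 * C) ^ 2 * H ^ (2 * θ) with hA
  have hwH : 0 < w * H := by positivity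
  have hApos : 0 < A := by positivity
  have hφ := rpow_le_tangent hHpos hH' hθ.le (by linarith)
  have hφ2 : 9000 * C / θ * H' ^ θ ≤ 9000 * C / θ * H ^ θ - 9000 * C * H ^ (θ - 1) * Q := by
    have h1 : θ * H ^ (θ - 1) * Q ≤ θ * H ^ (θ - 1) * (H - H') := by
      gcongr; linarith
    calc _ ≤ 9000 * C / θ * (H ^ θ - θ * H ^ (θ - 1) * Q) := by gcongr; linarith
      _ = _ := by field_simp
  have hΨ : √(w' * H' + (72 * C) ^ 2 * H' ^ (2 * θ)) ≤ √A + (H - w * Q) / (2 * √A) := by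
    have h0 : 0 ≤ w' * H' + (72 * C) ^ 2 * H' ^ (2 * θ) := by positivity
    refine (sqrt_le_tangent hApos h0).trans ?_
    suffices h : w' * H' + (72 * C) ^ 2 * H' ^ (2 * θ) - A ≤ H - w * Q by gcongr
    have h1 : H' ^ (2 * θ) ≤ H ^ (2 * θ) := Real.rpow_le_rpow hH' (by linarith) (by positivity)
    have h2 : (72 * C) ^ 2 * H' ^ (2 * θ) ≤ (72 * C) ^ 2 * H ^ (2 * θ) := by gcongr
    -- Raising the weight by one costs at most H; the energy drop returns w Q.
    have h3 : w' * H' ≤ (w + 1) * (H - Q) := mul_le_mul hw' hHH hH' (by linarith)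
    rw [hA]; nlinarith
  have key : 2 * δ - D + (D + δ) / 16 + 9 / 4 * ((H - w * Q) / (2 * √A))
      - 9000 * C * H ^ (θ - 1) * Q ≤ M / 32 → 
      lyap θ C w' D' H' + (D + δ) / 16 ≤ lyap θ C w D H + M / 32 := by
    intro h
    unfold lyap
    rw [← hA]
    linarith
  apply key
  rcases hKL with hKL | hKL
  · rcases le_or_gt ((72 * C) ^ 2 * H ^ (2 * θ)) (3 * (w * H)) with hc | hc
    · exact lyap_step_of_momentum_sqrt hC hw hD hHpos hM hA hQ0 hr hr1 hQ hKL hc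
    · exact lyap_step_of_momentum_rpow hC hw hD hδ hHpos hM hA hQ0 hb2 hKL hc
  · exact lyap_step_of_KL hC hw hD hHpos hM hA hQ0 hb2 hKL

/-- Summability of the path of a sequence that satisfies the energy inequality and a
Kurdyka-Lojasiewicz inequality with exponent at most one half. -/
theorem summable_of_energy_of_KL {θ C : ℝ} (hθ : 0 < θ) (hθ1 : θ ≤ 1 / 2) (hC : 0 < C)
    {w D δ F M : ℕ → ℝ} (hw : ∀ k, 1 ≤ w k) (hD : ∀ k, 0 ≤ D k) (hδ : ∀ k, 0 ≤ δ k)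
    (hM : ∀ k, 0 ≤ M k) (hF : ∀ k, 0 ≤ F k + w k * D k ^ 2 / 8)
    (hKL : ∀ k, 0 < F k → F k ^ (1 - θ) ≤ C * M k)
    (hwstep : ∀ k, w (k + 1) ≤ w k + 1)
    (hDstep : ∀ k, (w (k + 1) + 1) * D (k + 1) ≤ w k * D k + 2 * δ k)
    (hFstep : ∀ k, ∃ r, 1 / 3 ≤ r ∧ r ≤ 1 ∧ F (k + 1) + w (k + 1) * D (k + 1) ^ 2 / 8 ≤
      F k + w k * D k ^ 2 / 8 - energyDrop r (D k) (δ k))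
    (hMstep : ∀ k, M (k + 1) = D k + δ k ∨
      (M (k + 1) = M k ∧ D (k + 1) = 0 ∧ δ k = 0 ∧ w (k + 1) = 1)) :
    Summable (fun k => D k + δ k) := by
  set H : ℕ → ℝ := fun k => F k + w k * D k ^ 2 / 8 with hH
  have hC9 : 0 < 9 * C := by positivity
  -- Adding M/32 absorbs the KL error: the next M is D + δ, which uses half of the gain (D + δ)/16.
  set V : ℕ → ℝ := fun k => lyap θ (9 * C) (w k) (D k) (H k) + M k / 32 with hV
  have hV0 : ∀ k, 0 ≤ V k := fun k =>
    add_nonneg (lyap_nonneg hθ hC9 (hw k) (hD k) (hF k)) (by linarith [hM k])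
  have hstep : ∀ k, V (k + 1) + (D k + δ k) / 32 ≤ V k := by
    intro k
    obtain ⟨r, hr, hr1, hE⟩ := hFstep k
    rcases hMstep k with h | ⟨h1, h2, h3, h4⟩
    · have := lyap_step (C := 9 * C) (H := H k) (H' := H (k + 1)) (M := M k) hθ hθ1 hC9 (hw k)
        (hwstep k) (hD k) (hδ k) hr hr1 (hM k)
        (hw _) (hD _) (hDstep k) (hF (k + 1)) hE ?_
      · simp only [hV]; rw [h]; linarith
      -- The threshold wD²/64 yields H ≤ 9F above it and H ≤ (9/64) w D² below it. The second
      -- alternative also covers negative F.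
      · by_cases hc : w k * D k ^ 2 / 64 < F k
        · right
          have hp : 0 ≤ w k * D k ^ 2 := by have := hw k; positivity
          have hFk : 0 < F k := by linarith
          have h9 : H k ≤ 9 * F k := by simp only [hH]; linarith
          calc H k ^ (1 - θ) ≤ (9 * F k) ^ (1 - θ) :=
                Real.rpow_le_rpow (hF k) h9 (by linarith)
            _ = 9 ^ (1 - θ) * F k ^ (1 - θ) := Real.mul_rpow (by norm_num) hFk.le
            _ ≤ 9 ^ (1 : ℝ) * (C * M k) :=
                mul_le_mul (Real.rpow_le_rpow_of_exponent_le (by norm_num) (by linarith))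
                  (hKL k hFk) (by positivity) (by positivity)
            _ = _ := by rw [Real.rpow_one]; ring
        · left
          simp only [hH]; linarith
    · have hE' : H (k + 1) ≤ H k := by
        have := energyDrop_ge (D := D k) (δ := δ k) hr hr1
        have h0 : 0 ≤ (D k ^ 2 + δ k ^ 2) / 64 := by positivity
        simp only [hH]; linarith
      have := lyap_mono (D := D k) (w := w k) (w' := w (k + 1)) hθ hC9 (hw k)
        (by rw [h4]; exact hw k) (hF (k + 1)) hE'
      simp only [hV]
      rw [h1, h2, h3]
      have h5 : 1 * D k ≤ w k * D k := mul_le_mul_of_nonneg_right (hw k) (hD k)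
      have h6 := hD k
      linarith
  refine summable_of_sum_range_le (c := 32 * V 0) (fun k => add_nonneg (hD k) (hδ k)) fun n => ?_
  suffices h : V n + (∑ k ∈ Finset.range n, (D k + δ k)) / 32 ≤ V 0 by
    linarith [hV0 n]
  induction n with
  | zero => simp
  | succ n ih => rw [Finset.sum_range_succ]; linarith [hstep n]

/-- A nonnegative sequence with summable increments that vanishes infinitely often tends to
zero. -/
theorem tendsto_zero_of_le_add {a s : ℕ → ℝ} (ha : ∀ k, 0 ≤ a k) (hs0 : ∀ k, 0 ≤ s k)
    (hs : Summable s) (hstep : ∀ k, a (k + 1) ≤ a k + s k) (hz : ∃ᶠ k in atTop, a k = 0) :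
    Tendsto a atTop (𝓝 0) := by
  rw [Metric.tendsto_atTop]
  intro ε hε
  have ht := (tendsto_sum_nat_add s)
  obtain ⟨N, hN⟩ := (Metric.tendsto_atTop.1 ht) ε hε
  obtain ⟨m, hm, hm0⟩ := (frequently_atTop.1 hz) N
  refine ⟨m, fun n hn => ?_⟩
  obtain ⟨i, rfl⟩ := Nat.exists_eq_add_of_le hn
  have h1 : a (m + i) ≤ ∑ k ∈ Finset.range i, s (k + m) := by
    clear hn
    induction i with
    | zero => simp [hm0]
    | succ i ih =>
      rw [Finset.sum_range_succ, ← add_assoc]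
      have := hstep (m + i)
      rw [add_comm i m]; linarith
  have h2 : ∑ k ∈ Finset.range i, s (k + m) ≤ ∑' k, s (k + m) :=
    ((summable_nat_add_iff m).2 hs).sum_le_tsum _ (fun k _ => hs0 _)
  have h3 := hN m hm
  rw [Real.dist_eq, sub_zero] at h3 ⊢
  rw [abs_of_nonneg (ha _)]
  linarith [le_abs_self (∑' k, s (k + m))]

/-! ## Proximal gradient steps -/

variable {d : ℕ} {f : Euc d → ℝ} {g : Euc d → EReal} {L : ℝ}

/-- The mean value inequality, applied to the gradient increment on the ball of radius ‖v - u‖. -/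
theorem abs_sub_linearization_le (hf : Differentiable ℝ f)
    (hfL : ∀ u v : Euc d, ‖∇ f u - ∇ f v‖ ≤ L * ‖u - v‖) (hL : 0 < L) (u v : Euc d) :
    |f v - f u - inner ℝ (∇ f u) (v - u)| ≤ L * ‖v - u‖ ^ 2 := by
  have h := (convex_closedBall u ‖v - u‖).norm_image_sub_le_of_norm_fderiv_le' (𝕜 := ℝ) (f := f)
    (φ := fderiv ℝ f u) (C := L * ‖v - u‖) (x := u) (y := v) (fun x _ => hf x) ?_
    (Metric.mem_closedBall_self (norm_nonneg _)) (by simp [dist_eq_norm])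
  · rw [inner_gradient_left]
    simpa [Real.norm_eq_abs, sq, mul_assoc] using h
  · intro x hx
    rw [← toDual_gradient, ← toDual_gradient, ← map_sub, LinearIsometryEquiv.norm_map]
    refine (hfL x u).trans ?_
    rw [Metric.mem_closedBall, dist_eq_norm] at hx
    gcongr

theorem IsProper.coe_toReal (hg : IsProper g) {x : Euc d} (hx : g x ≠ ⊤) :
    ((g x).toReal : EReal) = g x :=
  EReal.coe_toReal hx (hg.1 x)

theorem objective_ne_top {f : Euc d → ℝ} {g : Euc d → EReal} {x : Euc d} (hx : g x ≠ ⊤) :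
    objective f g x ≠ ⊤ :=
  EReal.add_ne_top (EReal.coe_ne_top _) hx

theorem objective_eq_coe (hg : IsProper g) {x : Euc d} (hx : g x ≠ ⊤) :
    objective f g x = ((f x + (g x).toReal : ℝ) : EReal) := by
  rw [objective, EReal.coe_add, hg.coe_toReal hx]

theorem objective_ne_top_iff {x : Euc d} : objective f g x ≠ ⊤ ↔ g x ≠ ⊤ := by
  refine ⟨fun h hx => h ?_, objective_ne_top⟩
  rw [objective, hx]
  exact EReal.coe_add_top _

theorem lowerSemicontinuous_add_coe (hg_lsc : LowerSemicontinuous g)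
    {φ : Euc d → ℝ} (hφ : Continuous φ) :
    LowerSemicontinuous (fun x => g x + ((φ x : ℝ) : EReal)) := by
  refine hg_lsc.add' (continuous_coe_real_ereal.comp hφ).lowerSemicontinuous fun x => ?_
  exact EReal.continuousAt_add (Or.inr (EReal.coe_ne_bot _)) (Or.inr (EReal.coe_ne_top _))

/-- Coercivity comes from the lower bound on F: g ≥ m - f, and f is at most linear plus L‖· - x‖²,
which the proximal term dominates for such small η. -/
theorem proxSet_nonempty (hf : Differentiable ℝ f)
    (hfL : ∀ u v : Euc d, ‖∇ f u - ∇ f v‖ ≤ L * ‖u - v‖) (hL : 0 < L) (hg : IsProper g)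
    (hg_lsc : LowerSemicontinuous g) {m : ℝ} (hm : ∀ u, (m : EReal) ≤ objective f g u) {η : ℝ}
    (hη : 2 * L ≤ 1 / (2 * η)) (x : Euc d) : (proxSet η g x).Nonempty := by
  obtain ⟨z₀, hz₀⟩ := hg.2
  set a := 1 / (2 * η)
  set E := (g z₀).toReal + a * ‖z₀ - x‖ ^ 2 - m + f x with hE
  -- Beyond this radius the surplus L‖z - x‖² exceeds both the linear term and E, so no such z beats
  -- z₀.
  set R := 1 + (‖∇ f x‖ + |E|) / L + ‖z₀ - x‖ with hR
  have hcont : Continuous fun z : Euc d => a * ‖z - x‖ ^ 2 := by fun_prop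
  obtain ⟨p, -, hp⟩ := ((lowerSemicontinuous_add_coe hg_lsc hcont).lowerSemicontinuousOn
    (Metric.closedBall x R)).exists_isMinOn ⟨x, Metric.mem_closedBall_self (by positivity)⟩
    (isCompact_closedBall x R)
  have hz₀R : z₀ ∈ Metric.closedBall x R := by
    rw [Metric.mem_closedBall, dist_eq_norm, hR]
    have : 0 ≤ (‖∇ f x‖ + |E|) / L := by positivity
    linarith
  refine ⟨p, fun z => ?_⟩
  by_cases hz : z ∈ Metric.closedBall x R
  · exact hp hz
  refine (hp hz₀R).trans ?_
  by_cases hgz : g z = ⊤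
  · rw [hgz, EReal.top_add_coe]; exact le_top
  have h1 := hm z
  rw [objective_eq_coe hg hgz, EReal.coe_le_coe_iff] at h1
  dsimp only
  rw [← hg.coe_toReal hgz, ← hg.coe_toReal hz₀, ← EReal.coe_add, ← EReal.coe_add,
    EReal.coe_le_coe_iff]
  rw [Metric.mem_closedBall, dist_eq_norm, not_le] at hz
  have h2 := (abs_le.1 (abs_sub_linearization_le hf hfL hL x z)).2
  have h3 := real_inner_le_norm (∇ f x) (z - x)
  set N := ‖z - x‖
  have h4 : 2 * L * N ^ 2 ≤ a * N ^ 2 := by gcongr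
  have h5 : ‖∇ f x‖ + |E| < L * N := by
    have : (‖∇ f x‖ + |E|) / L < N := by linarith [norm_nonneg (z₀ - x)]
    rw [div_lt_iff₀ hL] at this
    linarith
  have h6 : 1 < N := by
    have : 0 ≤ (‖∇ f x‖ + |E|) / L := by positivity
    linarith [norm_nonneg (z₀ - x)]
  have h7 : (‖∇ f x‖ + |E|) * N ≤ L * N ^ 2 := by nlinarith
  have h8 : |E| ≤ |E| * N := le_mul_of_one_le_right (abs_nonneg _) h6.le
  have h9 := le_abs_self E
  nlinarith

theorem prox_mem_proxSet (hf : Differentiable ℝ f)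
    (hfL : ∀ u v : Euc d, ‖∇ f u - ∇ f v‖ ≤ L * ‖u - v‖) (hL : 0 < L) (hg : IsProper g)
    (hg_lsc : LowerSemicontinuous g) {m : ℝ} (hm : ∀ u, (m : EReal) ≤ objective f g u) {η : ℝ}
    (hη : 2 * L ≤ 1 / (2 * η)) (x : Euc d) : prox η g x ∈ proxSet η g x :=
  Classical.epsilon_spec (p := fun p => p ∈ proxSet η g x)
    (proxSet_nonempty hf hfL hL hg hg_lsc hm hη x)

theorem ne_top_of_mem_proxSet (hg : IsProper g) {η : ℝ} {x p : Euc d} (hp : p ∈ proxSet η g x) :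
    g p ≠ ⊤ := by
  obtain ⟨z, hz⟩ := hg.2
  intro h
  have := hp z
  rw [h, EReal.top_add_coe, top_le_iff] at this
  exact EReal.add_ne_top hz (EReal.coe_ne_top _) this

/-- The variational inequality that characterizes the proximal point. -/
theorem variational_inequality (hg : IsProper g) (hg_convex : IsConvexFun g) {η : ℝ} (hη : 0 < η)
    {x p z : Euc d} (hp : p ∈ proxSet η g x) (hz : g z ≠ ⊤) :
    (g p).toReal + 1 / η * inner ℝ (x - p) (z - p) ≤ (g z).toReal := by
  have hgp := ne_top_of_mem_proxSet hg hp
  set a := (g p).toReal with ha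
  set b := (g z).toReal with hb
  -- The minimizer is tested at p + t(z - p), and the inequality is divided by t. The error is O(t),
  -- hence can be made smaller than any violation.
  have key : ∀ t : ℝ, 0 < t → t < 1 →
      a + 1 / η * inner ℝ (x - p) (z - p) ≤ b + t * (1 / (2 * η) * ‖z - p‖ ^ 2) := by
    intro t ht ht1
    have h1 : g ((1 - t) • p + t • z) ≤ (((1 - t) * a + t * b : ℝ) : EReal) := by
      have := hg_convex (x := (p, a)) (y := (z, b)) (by simp [ha, hg.coe_toReal hgp])
        (by simp [hb, hg.coe_toReal hz]) (a := 1 - t) (b := t) (by linarith) ht.le (by ring)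
      simpa using this
    have h2 := (hp ((1 - t) • p + t • z)).trans (add_le_add_left h1 _)
    rw [← hg.coe_toReal hgp, ← EReal.coe_add, ← EReal.coe_add, EReal.coe_le_coe_iff, ← ha] at h2
    have h3 : (1 - t) • p + t • z - x = t • (z - p) - (x - p) := by module
    have h5 : ‖t • (z - p) - (x - p)‖ ^ 2 =
        t ^ 2 * ‖z - p‖ ^ 2 - 2 * (t * inner ℝ (x - p) (z - p)) + ‖x - p‖ ^ 2 := by
      rw [norm_sub_sq_real, norm_smul, inner_smul_left, Real.norm_eq_abs, mul_pow, sq_abs,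
        real_inner_comm, conj_trivial]
    rw [h3, h5, norm_sub_rev p x] at h2
    have h4 : 1 / η = 2 * (1 / (2 * η)) := by field_simp
    rw [h4]
    set c := 1 / (2 * η)
    refine le_of_mul_le_mul_left ?_ ht
    nlinarith
  by_contra! hcon
  set e := a + 1 / η * inner ℝ (x - p) (z - p) - b with he
  set N := 1 / (2 * η) * ‖z - p‖ ^ 2
  have hN : 0 ≤ N := by positivity
  have hepos : 0 < e := by linarith
  have h := key (min (1 / 2) (e / (2 * (N + 1)))) (by positivity)
    ((min_le_left _ _).trans_lt (by norm_num))
  have h1 : min (1 / 2) (e / (2 * (N + 1))) * N ≤ e / (2 * (N + 1)) * N := by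
    gcongr; exact min_le_right _ _
  have h2 : e / (2 * (N + 1)) * N ≤ e / 2 := by
    rw [div_mul_eq_mul_div, div_le_div_iff₀ (by positivity) (by norm_num)]
    nlinarith
  linarith

/-- Comparison of a proximal gradient step with an arbitrary point of the domain. -/
theorem proxGrad_compare (hg : IsProper g) (hg_convex : IsConvexFun g) {η : ℝ} (hη : 0 < η)
    {x z p v : Euc d} (hp : p ∈ proxSet η g (x - η • ∇ f z)) (hv : g v ≠ ⊤) :
    (g p).toReal + 1 / η * inner ℝ (x - p) (v - p) - inner ℝ (∇ f z) (v - p) ≤ (g v).toReal := by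
  have h := variational_inequality hg hg_convex hη hp hv
  have h1 : x - η • ∇ f z - p = (x - p) - η • ∇ f z := by abel
  rw [h1, inner_sub_left, inner_smul_left, conj_trivial, mul_sub, ← mul_assoc,
    one_div_mul_cancel hη.ne', one_mul] at h
  linarith

/-- Descent in one proximal gradient step with an extrapolated gradient. -/
theorem proxGrad_descent (hf : Differentiable ℝ f)
    (hfL : ∀ u v : Euc d, ‖∇ f u - ∇ f v‖ ≤ L * ‖u - v‖) (hL : 0 < L) (hg : IsProper g)
    (hg_convex : IsConvexFun g) {η : ℝ} (hη : 0 < η) (hηL : 4 * L ≤ 1 / η)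
    {x z p : Euc d} (hp : p ∈ proxSet η g (x - η • ∇ f z)) (hx : g x ≠ ⊤) :
    f p + (g p).toReal ≤
      f x + (g x).toReal + L * ‖z - x‖ * ‖p - x‖ - 3 * L * ‖p - x‖ ^ 2 := by
  have h1 := proxGrad_compare hg hg_convex hη hp hx
  rw [real_inner_self_eq_norm_sq] at h1
  have h2 := (abs_le.1 (abs_sub_linearization_le hf hfL hL x p)).2
  have h3 : inner ℝ (∇ f x) (p - x) + inner ℝ (∇ f z) (x - p) ≤ L * ‖z - x‖ * ‖p - x‖ := by
    rw [← neg_sub p x, inner_neg_right, ← sub_eq_add_neg, ← inner_sub_left]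
    refine (real_inner_le_norm _ _).trans ?_
    gcongr
    rw [norm_sub_rev z x]
    exact hfL x z
  rw [norm_sub_rev x p] at h1
  have h4 : 4 * L * ‖p - x‖ ^ 2 ≤ 1 / η * ‖p - x‖ ^ 2 := by gcongr
  linarith

/-! ### Subgradients from proximal steps and the KL inequality. -/

theorem frechetSubdiff_subset_limitingSubdiff (h : Euc d → EReal) (x : Euc d) :
    frechetSubdiff h x ⊆ limitingSubdiff h x := fun u hu =>
  ⟨hu.1, hu.2.1, fun _ => x, fun _ => u, tendsto_const_nhds, tendsto_const_nhds, fun _ => hu,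
    tendsto_const_nhds⟩

/-- The Frechet subgradient of the objective that a proximal gradient step produces. -/
theorem proxGrad_mem_frechetSubdiff (hf : Differentiable ℝ f) (hg : IsProper g)
    (hg_convex : IsConvexFun g) {η : ℝ} (hη : 0 < η) {x z p : Euc d}
    (hp : p ∈ proxSet η g (x - η • ∇ f z)) :
    ∇ f p - ∇ f z + (1 / η) • (x - p) ∈ frechetSubdiff (objective f g) p := by
  have hgp := ne_top_of_mem_proxSet hg hp
  have hFp := objective_eq_coe (f := f) hg hgp
  refine ⟨by rw [hFp]; exact EReal.coe_ne_bot _, objective_ne_top hgp, ?_⟩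
  rw [le_liminf_iff]
  intro y hy
  obtain ⟨ε, hyε, hε⟩ := EReal.lt_iff_exists_real_btwn.1 hy
  have hε' : ε < 0 := by exact_mod_cast hε
  have ho := (hasGradientAt_iff_isLittleO.1 (hf p).hasGradientAt).def (c := -ε / 2) (by linarith)
  filter_upwards [ho.filter_mono nhdsWithin_le_nhds, self_mem_nhdsWithin] with v hv hvp
  refine hyε.trans_le ?_
  have hN : 0 < ‖v - p‖ := norm_pos_iff.2 (sub_ne_zero.2 hvp)
  rw [EReal.le_div_iff_mul_le (by exact_mod_cast hN) (EReal.coe_ne_top _)]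
  by_cases hgv : g v = ⊤
  · have : objective f g v = ⊤ := by
      rw [objective, hgv]; exact EReal.coe_add_top _
    rw [this, hFp, EReal.top_sub_coe, EReal.top_sub_coe]
    exact le_top
  · rw [hFp, objective_eq_coe hg hgv, ← EReal.coe_sub, ← EReal.coe_sub, ← EReal.coe_mul,
      EReal.coe_le_coe_iff]
    have h1 := proxGrad_compare hg hg_convex hη hp hgv
    rw [Real.norm_eq_abs] at hv
    have h2 := (abs_le.1 hv).1
    rw [inner_add_left, inner_sub_left, inner_smul_left, conj_trivial]
    nlinarith

theorem proxGrad_subgradient_norm_le (hfL : ∀ u v : Euc d, ‖∇ f u - ∇ f v‖ ≤ L * ‖u - v‖)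
    (hL : 0 < L) {η : ℝ} (hη : 0 < η) (hηL : 1 / η ≤ 8 * L) (x z p : Euc d) :
    ‖∇ f p - ∇ f z + (1 / η) • (x - p)‖ ≤ 9 * L * (‖z - x‖ + ‖p - x‖) := by
  have h1 : ‖p - z‖ ≤ ‖p - x‖ + ‖z - x‖ := by
    rw [norm_sub_rev z x]; exact norm_sub_le_norm_sub_add_norm_sub _ _ _
  calc _ ≤ ‖∇ f p - ∇ f z‖ + ‖(1 / η) • (x - p)‖ := norm_add_le _ _
    _ ≤ L * (‖p - x‖ + ‖z - x‖) + 8 * L * ‖p - x‖ := by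
        rw [norm_smul, Real.norm_eq_abs, abs_of_pos (by positivity : 0 < 1 / η), norm_sub_rev x p]
        gcongr
        exact (hfL p z).trans (by gcongr)
    _ ≤ _ := by nlinarith [norm_nonneg (z - x), mul_nonneg hL.le (norm_nonneg (z - x))]

theorem deriv_desing {c θ s : ℝ} (hθ : 0 < θ) (hs : 0 < s) :
    deriv (desing c θ) s = c * s ^ (θ - 1) := by
  have := ((Real.hasDerivAt_rpow_const (p := θ) (Or.inl hs.ne')).const_mul (c / θ)).deriv
  unfold desing
  rw [this]
  field_simp

/-- The Kurdyka-Lojasiewicz inequality with exponent at most one half, for a real value of the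
function and a given subgradient. -/
theorem rpow_le_of_KL {c θ s N : ℝ} {S : Set (Euc d)} {u : Euc d} (hc : 0 < c) (hθ : 0 < θ)
    (hs : 0 < s) (hs1 : s ≤ 1) (hu : u ∈ S) (huN : ‖u‖ ≤ N)
    (h : 1 ≤ ENNReal.ofReal (deriv (desing c θ) s) * Metric.infEDist (0 : Euc d) S) :
    s ^ (1 - min θ (1 / 2)) ≤ c * N := by
  have h1 : Metric.infEDist (0 : Euc d) S ≤ ENNReal.ofReal N := by
    refine (Metric.infEDist_le_edist_of_mem hu).trans ?_
    rw [edist_dist, dist_zero_left]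
    exact ENNReal.ofReal_le_ofReal huN
  have hd : 0 ≤ c * s ^ (θ - 1) := by positivity
  have h2 : 1 ≤ ENNReal.ofReal (c * s ^ (θ - 1) * N) := by
    rw [ENNReal.ofReal_mul hd, ← deriv_desing hθ hs]
    exact h.trans (by gcongr)
  rw [ENNReal.one_le_ofReal] at h2
  -- For a gap s ≤ 1, lowering θ only weakens the inequality.
  have h3 : s ^ (1 - min θ (1 / 2)) ≤ s ^ (1 - θ) :=
    Real.rpow_le_rpow_of_exponent_ge hs hs1 (by linarith [min_le_left θ (1 / 2)])
  have h4 : s ^ (1 - θ) * s ^ (θ - 1) = 1 := by rw [← Real.rpow_add hs]; simp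
  have h5 : 0 < s ^ (1 - θ) := by positivity
  calc _ ≤ s ^ (1 - θ) * 1 := by rw [mul_one]; exact h3
    _ ≤ s ^ (1 - θ) * (c * s ^ (θ - 1) * N) := by gcongr
    _ = s ^ (1 - θ) * s ^ (θ - 1) * (c * N) := by ring
    _ = _ := by rw [h4, one_mul]

/-! ## Restart periods -/

section Periods

variable {q : ℕ → ℕ}

theorem checkpoint_succ (q : ℕ → ℕ) (t : ℕ) : checkpoint q (t + 1) = checkpoint q t + q (t + 1) :=
  Finset.sum_range_succ _ _

theorem checkpoint_zero (hq0 : q 0 = 0) : checkpoint q 0 = 0 := by simp [checkpoint, hq0]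

theorem checkpoint_strictMono (hq : ∀ t, 1 ≤ t → 1 ≤ q t) : StrictMono (checkpoint q) :=
  strictMono_nat_of_lt_succ fun t => by
    rw [checkpoint_succ]; have := hq (t + 1) (by omega); omega

theorem periodIndex_eq (hq : ∀ t, 1 ≤ t → 1 ≤ q t) {k t : ℕ} (h1 : checkpoint q t ≤ k)
    (h2 : k < checkpoint q (t + 1)) : periodIndex q k = t := by
  have hm := checkpoint_strictMono hq
  refine le_antisymm ?_ (Nat.le_findGreatest ((hm.id_le t).trans h1) h1)
  by_contra! h
  have h3 : checkpoint q (periodIndex q k) ≤ k :=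
    Nat.findGreatest_spec (P := fun t => checkpoint q t ≤ k) ((hm.id_le t).trans h1) h1
  have := hm.monotone (show t + 1 ≤ periodIndex q k from h)
  omega

theorem checkpoint_periodIndex_le (hq0 : q 0 = 0) (k : ℕ) : checkpoint q (periodIndex q k) ≤ k :=
  Nat.findGreatest_spec (P := fun t => checkpoint q t ≤ k) (Nat.zero_le k)
    (by simp [checkpoint_zero hq0])

theorem lt_checkpoint_periodIndex_succ (hq : ∀ t, 1 ≤ t → 1 ≤ q t) (k : ℕ) :
    k < checkpoint q (periodIndex q k + 1) := by
  by_contra! h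
  have hm := checkpoint_strictMono hq
  have : periodIndex q k + 1 ≤ periodIndex q k :=
    Nat.le_findGreatest (P := fun t => checkpoint q t ≤ k) ((hm.id_le _).trans h) h
  omega

/-- The position `k - Q_t + 1` of the index `k` in its period, as a real number. -/
noncomputable def weight (q : ℕ → ℕ) (k : ℕ) : ℝ :=
  (k : ℝ) - (checkpoint q (periodIndex q k) : ℝ) + 1

theorem momentum_eq (q : ℕ → ℕ) (k : ℕ) : momentum q k = 2 / (weight q k + 1) := by
  rw [momentum, weight]; ring_nf

theorem one_le_weight (hq0 : q 0 = 0) (k : ℕ) : 1 ≤ weight q k := by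
  have : (checkpoint q (periodIndex q k) : ℝ) ≤ k := by
    exact_mod_cast checkpoint_periodIndex_le hq0 k
  rw [weight]; linarith

theorem weight_checkpoint (hq : ∀ t, 1 ≤ t → 1 ≤ q t) (t : ℕ) : weight q (checkpoint q t) = 1 := by
  rw [weight, periodIndex_eq hq le_rfl (checkpoint_strictMono hq (Nat.lt_succ_self t))]
  ring

theorem weight_succ (hq0 : q 0 = 0) (hq : ∀ t, 1 ≤ t → 1 ≤ q t) {k : ℕ}
    (hk : ¬ ∃ t, checkpoint q t = k + 1) : weight q (k + 1) = weight q k + 1 := by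
  have h1 := checkpoint_periodIndex_le hq0 k
  have h2 := lt_checkpoint_periodIndex_succ hq k
  have h3 : checkpoint q (periodIndex q k + 1) ≠ k + 1 := fun h => hk ⟨_, h⟩
  rw [weight, weight, periodIndex_eq hq (k := k + 1) (t := periodIndex q k) (by omega) (by omega)]
  push_cast
  ring

end Periods

/-! ## The iteration -/

/-- The hypotheses on the objective and on the parameters, without the Kurdyka-Lojasiewicz
property. -/
structure Setting {d : ℕ} (f : Euc d → ℝ) (g : Euc d → EReal) (L m : ℝ) (q : ℕ → ℕ)
    (rule : ResetRule) (lam β : ℕ → ℝ) : Prop where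
  L_pos : 0 < L
  diff : Differentiable ℝ f
  lip : ∀ u v : Euc d, ‖∇ f u - ∇ f v‖ ≤ L * ‖u - v‖
  proper : IsProper g
  convex : IsConvexFun g
  lsc : LowerSemicontinuous g
  lower : ∀ u, (m : EReal) ≤ objective f g u
  q_zero : q 0 = 0
  q_pos : ∀ t, 1 ≤ t → 1 ≤ q t
  q_rule : rule = ResetRule.previous → ∃ᶠ t in atTop, 2 ≤ q t
  beta_eq : ∀ k, β k = 1 / (8 * L)
  lam_mem : ∀ k, lam k ∈ Set.Icc (β k) ((1 + momentum q (k + 1)) * β k)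

/-- The step from `k` to `k + 1` is not undone by a reset. -/
def Effective (rule : ResetRule) (q : ℕ → ℕ) (k : ℕ) : Prop :=
  rule = ResetRule.latest ∨ ¬ ∃ t, checkpoint q t = k + 1

/-- The point computed by iteration `k`, before a reset. -/
noncomputable def proxPoint {d : ℕ} (rule : ResetRule) (f : Euc d → ℝ) (g : Euc d → EReal)
    (q : ℕ → ℕ) (lam β : ℕ → ℝ) (xi : Euc d) (k : ℕ) : Euc d :=
  prox (lam k) g (xSeq rule f g q lam β xi k - lam k • ∇ f (zSeq rule f g q lam β xi k))

/-- The real value of the objective at `x_k` (when it is finite). -/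
noncomputable def value {d : ℕ} (rule : ResetRule) (f : Euc d → ℝ) (g : Euc d → EReal) (q : ℕ → ℕ)
    (lam β : ℕ → ℝ) (xi : Euc d) (k : ℕ) : ℝ :=
  f (xSeq rule f g q lam β xi k) + (g (xSeq rule f g q lam β xi k)).toReal

open Classical in
/-- The last effective step before `k`. -/
noncomputable def lastEffective (rule : ResetRule) (q : ℕ → ℕ) : ℕ → ℕ
  | 0 => 0
  | k + 1 => if Effective rule q k then k else lastEffective rule q k

/-- The size of the last effective step before `k`. -/
noncomputable def lastStep {d : ℕ} (rule : ResetRule) (f : Euc d → ℝ) (g : Euc d → EReal)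
    (q : ℕ → ℕ) (lam β : ℕ → ℝ) (xi : Euc d) (k : ℕ) : ℝ :=
  ‖ySeq rule f g q lam β xi (lastEffective rule q k) -
      xSeq rule f g q lam β xi (lastEffective rule q k)‖ +
    ‖xSeq rule f g q lam β xi (lastEffective rule q k + 1) -
      xSeq rule f g q lam β xi (lastEffective rule q k)‖

namespace Setting

variable {d : ℕ} {f : Euc d → ℝ} {g : Euc d → EReal} {L m : ℝ} {q : ℕ → ℕ} {rule : ResetRule}
  {lam β : ℕ → ℝ} (xi : Euc d)

local notation "xs" => xSeq rule f g q lam β xi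
local notation "ys" => ySeq rule f g q lam β xi
local notation "zs" => zSeq rule f g q lam β xi

theorem zSeq_eq (k : ℕ) :
    zs k = (1 - momentum q (k + 1)) • ys k + momentum q (k + 1) • xs k := rfl

theorem momentum_nonneg (S : Setting f g L m q rule lam β) (k : ℕ) : 0 ≤ momentum q k := by
  have := one_le_weight S.q_zero k
  rw [momentum_eq]; positivity

theorem momentum_le_one (S : Setting f g L m q rule lam β) (k : ℕ) : momentum q k ≤ 1 := by
  have := one_le_weight S.q_zero k
  rw [momentum_eq, div_le_one (by positivity)]; linarith

theorem beta_pos (S : Setting f g L m q rule lam β) (k : ℕ) : 0 < β k := by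
  have := S.L_pos
  rw [S.beta_eq]; positivity

theorem lam_pos (S : Setting f g L m q rule lam β) (k : ℕ) : 0 < lam k := (S.beta_pos k).trans_le
    (S.lam_mem k).1

theorem four_mul_le_inv_lam (S : Setting f g L m q rule lam β) (k : ℕ) : 4 * L ≤ 1 / lam k := by
  have hL := S.L_pos
  rw [le_div_iff₀ (S.lam_pos k)]
  have h1 := (S.lam_mem k).2
  have h2 := S.momentum_le_one (k + 1)
  have h3 : lam k ≤ 2 * β k := h1.trans (by nlinarith [S.beta_pos k])
  rw [S.beta_eq] at h3
  calc 4 * L * lam k ≤ 4 * L * (2 * (1 / (8 * L))) := by gcongr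
    _ = 1 := by field_simp; norm_num

theorem inv_lam_le (S : Setting f g L m q rule lam β) (k : ℕ) : 1 / lam k ≤ 8 * L := by
  have hL := S.L_pos
  have h1 := (S.lam_mem k).1
  rw [S.beta_eq] at h1
  calc 1 / lam k ≤ 1 / (1 / (8 * L)) := by gcongr
    _ = _ := by rw [one_div_one_div]

local notation "ps" => proxPoint rule f g q lam β xi

theorem proxPoint_mem (S : Setting f g L m q rule lam β) (k : ℕ) : ps k ∈ proxSet (lam k) g
    (xs k - lam k • ∇ f (zs k)) := by
  refine prox_mem_proxSet S.diff S.lip S.L_pos S.proper S.lsc S.lower ?_ _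
  have h := S.four_mul_le_inv_lam k
  have e : 1 / (2 * lam k) = 1 / lam k / 2 := by rw [div_div, mul_comm]
  rw [e]; linarith

theorem state_succ_of_checkpoint (S : Setting f g L m q rule lam β) {k : ℕ} (hk : ∃ t,
    checkpoint q t = k + 1) :
    xs (k + 1) = rule.point (xs k) (ps k) ∧ ys (k + 1) = xs (k + 1) := by
  have e : xs k - lam k • gradMap g (lam k) (xs k) (∇ f (zs k)) = ps k := by
    rw [gradMap, smul_smul, mul_one_div_cancel (S.lam_pos k).ne', one_smul, sub_sub_cancel]; rfl
  rw [← e]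
  constructor
  · simp only [xSeq, zSeq, state, if_pos hk]
  · simp only [xSeq, ySeq, state, if_pos hk]

theorem state_succ_of_not_checkpoint (S : Setting f g L m q rule lam β) {k : ℕ} (hk : ¬ ∃ t,
    checkpoint q t = k + 1) :
    xs (k + 1) = ps k ∧
      ys (k + 1) = zs k - β k • ((1 / lam k) • (xs k - ps k)) := by
  have e : xs k - lam k • gradMap g (lam k) (xs k) (∇ f (zs k)) = ps k := by
    rw [gradMap, smul_smul, mul_one_div_cancel (S.lam_pos k).ne', one_smul, sub_sub_cancel]; rfl
  constructor
  · rw [← e]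
    simp only [xSeq, zSeq, state, if_neg hk]
  · simp only [xSeq, ySeq, zSeq, state, if_neg hk]
    rfl

theorem xSeq_succ_of_effective (S : Setting f g L m q rule lam β) {k : ℕ}
    (hk : Effective rule q k) : xs (k + 1) = ps k := by
  by_cases hc : ∃ t, checkpoint q t = k + 1
  · rw [(S.state_succ_of_checkpoint xi hc).1, hk.resolve_right (not_not.2 hc)]; rfl
  · exact (S.state_succ_of_not_checkpoint xi hc).1

theorem succ_of_not_effective (S : Setting f g L m q rule lam β) {k : ℕ}
    (hk : ¬ Effective rule q k) :
    xs (k + 1) = xs k ∧ ys (k + 1) = xs (k + 1) ∧ weight q (k + 1) = 1 := by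
  rw [Effective, not_or, not_not] at hk
  obtain ⟨h1, h2⟩ := hk
  have hr : rule = ResetRule.previous := by cases rule <;> simp_all
  refine ⟨?_, (S.state_succ_of_checkpoint xi h2).2, ?_⟩
  · rw [(S.state_succ_of_checkpoint xi h2).1]; subst hr; rfl
  · obtain ⟨t, ht⟩ := h2
    rw [← ht, weight_checkpoint S.q_pos]

/-- Under the rule `previous`, the first step of a period of length at least 2 is kept. -/
theorem frequently_effective (S : Setting f g L m q rule lam β) : ∃ᶠ k in atTop,
    Effective rule q k := by
  cases hr : rule with
  | latest => exact (Eventually.of_forall fun k => Or.inl rfl).frequently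
  | previous =>
    have hm := checkpoint_strictMono S.q_pos
    refine frequently_atTop.2 fun N => ?_
    obtain ⟨t, ht, ht2⟩ := frequently_atTop.1 (S.q_rule hr) (N + 1)
    obtain ⟨s, rfl⟩ : ∃ s, t = s + 1 := ⟨t - 1, by omega⟩
    refine ⟨checkpoint q s, le_trans (by omega) hm.le_apply, Or.inr ?_⟩
    rintro ⟨u, hu⟩
    have h1 : s < u := hm.lt_iff_lt.1 (by omega)
    have h2 := hm.monotone (show s + 1 ≤ u from h1)
    rw [checkpoint_succ] at h2
    omega

/-! ### Recursions for the momentum and the energy. -/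

theorem norm_zSeq_sub (S : Setting f g L m q rule lam β) (k : ℕ) :
    ‖zs k - xs k‖ = (1 - momentum q (k + 1)) * ‖ys k - xs k‖ := by
  have h : zs k - xs k = (1 - momentum q (k + 1)) • (ys k - xs k) := by
    rw [zSeq_eq]; module
  rw [h, norm_smul, Real.norm_eq_abs, abs_of_nonneg (by linarith [S.momentum_le_one (k + 1)])]

theorem norm_zSeq_sub_le (S : Setting f g L m q rule lam β) (k : ℕ) :
    ‖zs k - xs k‖ ≤ ‖ys k - xs k‖ := by
  rw [S.norm_zSeq_sub]
  exact mul_le_of_le_one_left (norm_nonneg _) (by linarith [S.momentum_nonneg (k + 1)])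

/-- Here y_{k+1} - x_{k+1} = (z_k - x_k) + ((λ_k - β_k)/λ_k)(x_k - x_{k+1}), and λ_k - β_k ≤ α_{k+1}
β_k ≤ α_{k+1} λ_k. -/
theorem norm_ySeq_sub_succ_le (S : Setting f g L m q rule lam β) {k : ℕ} (hk : ¬ ∃ t,
    checkpoint q t = k + 1) :
    ‖ys (k + 1) - xs (k + 1)‖ ≤ (1 - momentum q (k + 1)) * ‖ys k - xs k‖ +
      momentum q (k + 1) * ‖xs (k + 1) - xs k‖ := by
  obtain ⟨h1, h2⟩ := S.state_succ_of_not_checkpoint xi hk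
  have hl := S.lam_pos k
  have hb := S.beta_pos k
  have h3 : ys (k + 1) - xs (k + 1) =
      (zs k - xs k) + ((lam k - β k) / lam k) • (xs k - xs (k + 1)) := by
    rw [h2, h1, smul_smul, sub_div, div_self hl.ne', mul_one_div]; module
  have h4 : |(lam k - β k) / lam k| ≤ momentum q (k + 1) := by
    rw [abs_of_nonneg (div_nonneg (by linarith [(S.lam_mem k).1]) hl.le), div_le_iff₀ hl]
    have h5 := (S.lam_mem k).2
    have h6 := mul_le_mul_of_nonneg_left (S.lam_mem k).1 (S.momentum_nonneg (k + 1))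
    linarith
  rw [h3]
  refine (norm_add_le _ _).trans ?_
  rw [S.norm_zSeq_sub, norm_smul, Real.norm_eq_abs, norm_sub_rev (xs k)]
  gcongr

local notation "Fs" => value rule f g q lam β xi

theorem weight_succ_le (S : Setting f g L m q rule lam β) (k : ℕ) : weight q
    (k + 1) ≤ weight q k + 1 := by
  by_cases hc : ∃ t, checkpoint q t = k + 1
  · obtain ⟨t, ht⟩ := hc
    rw [← ht, weight_checkpoint S.q_pos]
    linarith [one_le_weight S.q_zero k]
  · rw [weight_succ S.q_zero S.q_pos hc]

theorem weight_mul_norm_succ_le (S : Setting f g L m q rule lam β) (k : ℕ) :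
    (weight q (k + 1) + 1) * ‖ys (k + 1) - xs (k + 1)‖ ≤
      weight q k * ‖ys k - xs k‖ + 2 * ‖xs (k + 1) - xs k‖ := by
  have hw := one_le_weight S.q_zero k
  by_cases hc : ∃ t, checkpoint q t = k + 1
  · rw [(S.state_succ_of_checkpoint xi hc).2, sub_self, norm_zero, mul_zero]
    positivity
  · have h := S.norm_ySeq_sub_succ_le xi hc
    rw [momentum_eq, weight_succ S.q_zero S.q_pos hc] at h
    rw [weight_succ S.q_zero S.q_pos hc]
    set w := weight q k
    calc _ ≤ (w + 1 + 1) * ((1 - 2 / (w + 1 + 1)) * ‖ys k - xs k‖ +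
          2 / (w + 1 + 1) * ‖xs (k + 1) - xs k‖) := by gcongr
      _ = _ := by field_simp; ring

/-- Convexity of the square, together with (w+1)(1-α) = w - (1-α) for α = 2/(w+2). -/
theorem weight_mul_sq_succ_le (S : Setting f g L m q rule lam β) (k : ℕ) :
    weight q (k + 1) * ‖ys (k + 1) - xs (k + 1)‖ ^ 2 ≤
      weight q k * ‖ys k - xs k‖ ^ 2 - ((1 - momentum q (k + 1)) * ‖ys k - xs k‖ ^ 2) +
        2 * ‖xs (k + 1) - xs k‖ ^ 2 := by
  have hw := one_le_weight S.q_zero k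
  have hα := S.momentum_nonneg (k + 1)
  have hα1 := S.momentum_le_one (k + 1)
  by_cases hc : ∃ t, checkpoint q t = k + 1
  · rw [(S.state_succ_of_checkpoint xi hc).2, sub_self, norm_zero]
    have : (1 - momentum q (k + 1)) * ‖ys k - xs k‖ ^ 2 ≤ weight q k * ‖ys k - xs k‖ ^ 2 := by
      gcongr; linarith
    have : 0 ≤ 2 * ‖xs (k + 1) - xs k‖ ^ 2 := by positivity
    simp; linarith
  · have h := S.norm_ySeq_sub_succ_le xi hc
    have h2 : ‖ys (k + 1) - xs (k + 1)‖ ^ 2 ≤ (1 - momentum q (k + 1)) * ‖ys k - xs k‖ ^ 2 +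
        momentum q (k + 1) * ‖xs (k + 1) - xs k‖ ^ 2 := by
      refine (pow_le_pow_left₀ (norm_nonneg _) h 2).trans ?_
      nlinarith [mul_nonneg (mul_nonneg hα (sub_nonneg.2 hα1))
        (sq_nonneg (‖ys k - xs k‖ - ‖xs (k + 1) - xs k‖))]
    rw [momentum_eq, weight_succ S.q_zero S.q_pos hc] at h2 ⊢
    set w := weight q k
    set D := ‖ys k - xs k‖
    set e := ‖xs (k + 1) - xs k‖
    calc _ ≤ (w + 1) * ((1 - 2 / (w + 1 + 1)) * D ^ 2 + 2 / (w + 1 + 1) * e ^ 2) := by gcongr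
      _ = w * D ^ 2 - (1 - 2 / (w + 1 + 1)) * D ^ 2 + 2 * ((w + 1) / (w + 2)) * e ^ 2 := by
          field_simp; ring
      _ ≤ _ := by
          have : (w + 1) / (w + 2) ≤ 1 := by rw [div_le_one (by positivity)]; linarith
          gcongr; linarith

theorem value_succ_le (S : Setting f g L m q rule lam β) {k : ℕ} (hk : g (xs k) ≠ ⊤) :
    Fs (k + 1) ≤ Fs k + L * ((1 - momentum q (k + 1)) * ‖ys k - xs k‖ * ‖xs (k + 1) - xs k‖ -
      3 * ‖xs (k + 1) - xs k‖ ^ 2) := by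
  by_cases he : Effective rule q k
  · have h := proxGrad_descent S.diff S.lip S.L_pos S.proper S.convex (S.lam_pos k)
      (S.four_mul_le_inv_lam k) (S.proxPoint_mem xi k) hk
    rw [← S.xSeq_succ_of_effective xi he, S.norm_zSeq_sub] at h
    unfold value
    linarith
  · unfold value
    rw [(S.succ_of_not_effective xi he).1]
    simp

theorem energy_succ_le (S : Setting f g L m q rule lam β) {k : ℕ} (hk : g (xs k) ≠ ⊤) : ∃ r,
    1 / 3 ≤ r ∧ r ≤ 1 ∧
    Fs (k + 1) / L + weight q (k + 1) * ‖ys (k + 1) - xs (k + 1)‖ ^ 2 / 8 ≤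
      Fs k / L + weight q k * ‖ys k - xs k‖ ^ 2 / 8 -
        energyDrop r ‖ys k - xs k‖ ‖xs (k + 1) - xs k‖ := by
  have hL := S.L_pos
  have hw := one_le_weight S.q_zero k
  have h1 : Fs (k + 1) / L ≤ Fs k / L + ((1 - momentum q (k + 1)) * ‖ys k - xs k‖ *
      ‖xs (k + 1) - xs k‖ - 3 * ‖xs (k + 1) - xs k‖ ^ 2) := by
    have := div_le_div_of_nonneg_right (S.value_succ_le xi hk) hL.le
    rwa [add_div, mul_div_cancel_left₀ _ hL.ne'] at this
  by_cases hc : ∃ t, checkpoint q t = k + 1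
  -- At a restart the whole kinetic term is discarded, more than r = 1/3 requires.
  · refine ⟨1 / 3, le_rfl, by norm_num, ?_⟩
    have hα : momentum q (k + 1) = 1 := by
      obtain ⟨t, ht⟩ := hc
      rw [momentum_eq, ← ht, weight_checkpoint S.q_pos]; norm_num
    rw [(S.state_succ_of_checkpoint xi hc).2, sub_self, norm_zero]
    rw [hα] at h1
    unfold energyDrop
    nlinarith [norm_nonneg (ys k - xs k), norm_nonneg (xs (k + 1) - xs k),
      mul_nonneg (norm_nonneg (ys k - xs k)) (norm_nonneg (xs (k + 1) - xs k)),
      mul_nonneg (sub_nonneg.2 hw) (sq_nonneg ‖ys k - xs k‖)]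
  · refine ⟨1 - momentum q (k + 1), ?_, by linarith [S.momentum_nonneg (k + 1)], ?_⟩
    · rw [momentum_eq, weight_succ S.q_zero S.q_pos hc, le_sub_comm, div_le_iff₀ (by positivity)]
      linarith
    · have h2 := S.weight_mul_sq_succ_le xi k
      unfold energyDrop
      linarith

theorem ne_top_succ (S : Setting f g L m q rule lam β) {k : ℕ} (hk : g (xs k) ≠ ⊤) : g (xs
    (k + 1)) ≠ ⊤ := by
  by_cases he : Effective rule q k
  · rw [S.xSeq_succ_of_effective xi he]
    exact ne_top_of_mem_proxSet S.proper (S.proxPoint_mem xi k)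
  · rwa [(S.succ_of_not_effective xi he).1]

theorem tendsto_lastEffective (S : Setting f g L m q rule lam β) : Tendsto
    (lastEffective rule q) atTop atTop := by
  have hmono : ∀ k, lastEffective rule q k ≤ k ∧
      lastEffective rule q k ≤ lastEffective rule q (k + 1) := by
    intro k
    induction k with
    | zero => simp [lastEffective]
    | succ k ih =>
      have h1 : lastEffective rule q (k + 1) ≤ k := by
        rw [lastEffective]; split_ifs; exacts [le_rfl, ih.1]
      refine ⟨h1.trans (Nat.le_succ k), ?_⟩
      conv_rhs => rw [lastEffective]
      split_ifs
      exacts [h1.trans (Nat.le_succ k), le_rfl]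
  refine tendsto_atTop_atTop_of_monotone (monotone_nat_of_le_succ fun k => (hmono k).2) fun b => ?_
  obtain ⟨k, hk, he⟩ := frequently_atTop.1 S.frequently_effective b
  exact ⟨k + 1, by rw [lastEffective, if_pos he]; exact hk⟩

/-- From some index on, every iterate is the outcome of its last effective step. -/
theorem exists_forall_eq_proxPoint (S : Setting f g L m q rule lam β) :
    ∃ K, ∀ k, K ≤ k → g (xs k) ≠ ⊤ ∧ xs k = xs (lastEffective rule q k + 1) ∧
      xs k = ps (lastEffective rule q k) := by
  -- The initial point may lie outside dom g; one effective step enters the domain for good.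
  obtain ⟨K, he⟩ := S.frequently_effective.exists
  refine ⟨K + 1, fun k hk => ?_⟩
  induction k, hk using Nat.le_induction with
  | base =>
    rw [lastEffective, if_pos he, S.xSeq_succ_of_effective xi he]
    exact ⟨ne_top_of_mem_proxSet S.proper (S.proxPoint_mem xi K), rfl, rfl⟩
  | succ k hk ih =>
    refine ⟨S.ne_top_succ xi ih.1, ?_⟩
    rw [lastEffective]
    split_ifs with h
    · exact ⟨rfl, S.xSeq_succ_of_effective xi h⟩
    · rw [(S.succ_of_not_effective xi h).1]
      exact ih.2

-- Subgradients and comparison at the iterates.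

local notation "Ms" => lastStep rule f g q lam β xi

theorem lastStep_nonneg (k : ℕ) : 0 ≤ Ms k := by unfold lastStep; positivity

theorem lastStep_succ (S : Setting f g L m q rule lam β) (k : ℕ) :
    Ms (k + 1) = ‖ys k - xs k‖ + ‖xs (k + 1) - xs k‖ ∨
      (Ms (k + 1) = Ms k ∧ ‖ys (k + 1) - xs (k + 1)‖ = 0 ∧ ‖xs (k + 1) - xs k‖ = 0 ∧
        weight q (k + 1) = 1) := by
  by_cases he : Effective rule q k
  · left; rw [lastStep, lastEffective, if_pos he]
  · right
    obtain ⟨h1, h2, h3⟩ := S.succ_of_not_effective xi he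
    refine ⟨?_, by rw [h2, sub_self, norm_zero], by rw [h1, sub_self, norm_zero], h3⟩
    rw [lastStep, lastEffective, if_neg he, lastStep]

theorem exists_subgradient (S : Setting f g L m q rule lam β) {k : ℕ}
    (h1 : xs k = xs (lastEffective rule q k + 1)) (h2 : xs k = ps (lastEffective rule q k)) :
    ∃ u ∈ frechetSubdiff (objective f g) (xs k), ‖u‖ ≤ 9 * L * Ms k := by
  have hL := S.L_pos
  set i := lastEffective rule q k with hi
  refine ⟨_, h2 ▸ proxGrad_mem_frechetSubdiff S.diff S.proper S.convex (S.lam_pos i)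
    (S.proxPoint_mem xi i), ?_⟩
  refine (proxGrad_subgradient_norm_le S.lip S.L_pos (S.lam_pos i) (S.inv_lam_le i) _ _ _).trans ?_
  rw [lastStep, ← hi, ← h1]
  gcongr
  exact S.norm_zSeq_sub_le xi i

/-- A substitute for continuity of g: with a cluster point as competitor v, the error term tends to
0 along a subsequence. -/
theorem toReal_le_add (S : Setting f g L m q rule lam β) {k : ℕ}
    (h1 : xs k = xs (lastEffective rule q k + 1)) (h2 : xs k = ps (lastEffective rule q k))
    {v : Euc d} (hv : g v ≠ ⊤) :
    (g (xs k)).toReal ≤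
      (g v).toReal + (9 * L * Ms k + ‖∇ f v‖ + L * ‖v - xs k‖) * ‖v - xs k‖ := by
  have hL := S.L_pos
  have hM : Ms k = ‖ys (lastEffective rule q k) - xs (lastEffective rule q k)‖ +
    ‖xs (lastEffective rule q k + 1) - xs (lastEffective rule q k)‖ := rfl
  set i := lastEffective rule q k with hi
  have h := proxGrad_compare S.proper S.convex (S.lam_pos i) (S.proxPoint_mem xi i) hv
  rw [← h1] at hM
  rw [← h2] at h
  have hz := S.norm_zSeq_sub_le xi i
  have e1 : -(1 / lam i * inner ℝ (xs i - xs k) (v - xs k)) ≤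
      8 * L * ‖xs k - xs i‖ * ‖v - xs k‖ := by
    have := (abs_le.1 (abs_real_inner_le_norm (xs i - xs k) (v - xs k))).1
    have h8 := S.inv_lam_le i
    have hp : 0 < 1 / lam i := one_div_pos.2 (S.lam_pos i)
    calc _ = 1 / lam i * (-inner ℝ (xs i - xs k) (v - xs k)) := by ring
      _ ≤ 1 / lam i * (‖xs i - xs k‖ * ‖v - xs k‖) := by gcongr; linarith
      _ ≤ 8 * L * (‖xs i - xs k‖ * ‖v - xs k‖) := by gcongr
      _ = _ := by rw [norm_sub_rev]; ring
  have e2 : ‖∇ f (zs i)‖ ≤ ‖∇ f v‖ + L * (‖v - xs k‖ + Ms k) := by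
    have a1 : ‖∇ f (zs i)‖ ≤ ‖∇ f v‖ + ‖∇ f (zs i) - ∇ f v‖ := by
      have := norm_add_le (∇ f v) (∇ f (zs i) - ∇ f v); simpa using this
    have a2 : ‖zs i - v‖ ≤ ‖v - xs k‖ + Ms k := by
      have : zs i - v = (zs i - xs i) - (xs k - xs i) - (v - xs k) := by abel
      rw [this]
      have b1 := norm_sub_le (zs i - xs i - (xs k - xs i)) (v - xs k)
      have b2 := norm_sub_le (zs i - xs i) (xs k - xs i)
      linarith
    have a3 := (S.lip (zs i) v).trans (mul_le_mul_of_nonneg_left a2 hL.le)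
    linarith
  have e3 := real_inner_le_norm (∇ f (zs i)) (v - xs k)
  have e4 := mul_le_mul_of_nonneg_right e2 (norm_nonneg (v - xs k))
  have e5 : 8 * L * ‖xs k - xs i‖ * ‖v - xs k‖ ≤ 8 * L * Ms k * ‖v - xs k‖ := by
    gcongr; linarith [norm_nonneg (ys i - xs i)]
  linarith

end Setting

/-! ## Convergence -/

theorem summable_pathLength {d : ℕ} {q : ℕ → ℕ} (hq0 : q 0 = 0) (hq : ∀ t, 1 ≤ t → 1 ≤ q t)
    {x : ℕ → Euc d} (hx : Summable fun k => ‖x (k + 1) - x k‖) : Summable (pathLength q x) := by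
  refine summable_of_sum_range_le (c := ∑' k, ‖x (k + 1) - x k‖) (fun _ => Real.sqrt_nonneg _)
    fun T => ?_
  refine le_trans ?_ (hx.sum_le_tsum (Finset.range (checkpoint q T)) fun _ _ => norm_nonneg _)
  induction T with
  | zero => simp [checkpoint_zero hq0]
  | succ T ih =>
    have h1 := (checkpoint_strictMono hq).monotone (Nat.le_succ T)
    rw [Finset.sum_range_succ, ← Finset.sum_range_add_sum_Ico _ h1]
    refine add_le_add ih (Real.sqrt_le_iff.2 ⟨Finset.sum_nonneg fun _ _ => norm_nonneg _, ?_⟩)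
    exact Finset.sum_sq_le_sq_sum_of_nonneg fun _ _ => norm_nonneg _

/-- A sequence in a compact set approaches the set of its cluster points. -/
theorem eventually_infEDist_clusterPts_lt {d : ℕ} {C : Set (Euc d)} (hC : IsCompact C)
    {x : ℕ → Euc d} (hx : ∀ᶠ k in atTop, x k ∈ C) {ε : ℝ} (hε : 0 < ε) :
    ∀ᶠ k in atTop, Metric.infEDist (x k) {ω | MapClusterPt ω atTop x} < ENNReal.ofReal ε := by
  by_contra h
  rw [not_eventually] at h
  have hU : IsOpen {v : Euc d | Metric.infEDist v {ω | MapClusterPt ω atTop x} <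
      ENNReal.ofReal ε} := isOpen_lt Metric.continuous_infEDist continuous_const
  obtain ⟨ω, hω, hωx⟩ := (hC.diff hU).exists_mapClusterPt_of_frequently
    ((h.and_eventually hx).mono fun k hk => ⟨hk.2, hk.1⟩)
  refine hω.2 ?_
  have : Metric.infEDist ω {ω | MapClusterPt ω atTop x} = 0 := Metric.infEDist_zero_of_mem hωx
  rw [Set.mem_ofPred_eq, this]
  exact ENNReal.ofReal_pos.2 hε

namespace Setting

variable {d : ℕ} {f : Euc d → ℝ} {g : Euc d → EReal} {L m : ℝ} {q : ℕ → ℕ} {rule : ResetRule}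
  {lam β : ℕ → ℝ} (xi : Euc d)

local notation "xs" => xSeq rule f g q lam β xi
local notation "ys" => ySeq rule f g q lam β xi
local notation "zs" => zSeq rule f g q lam β xi
local notation "ps" => proxPoint rule f g q lam β xi
local notation "Fs" => value rule f g q lam β xi
local notation "Ms" => lastStep rule f g q lam β xi

/-- The normalized energy `F(x_k) / L + w_k ‖y_k - x_k‖² / 8`. -/
noncomputable def energy (L : ℝ) (xi : Euc d) (rule : ResetRule) (f : Euc d → ℝ)
    (g : Euc d → EReal) (q : ℕ → ℕ) (lam β : ℕ → ℝ) (k : ℕ) : ℝ :=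
  value rule f g q lam β xi k / L +
    weight q k * ‖ySeq rule f g q lam β xi k - xSeq rule f g q lam β xi k‖ ^ 2 / 8

local notation "Hs" => energy L xi rule f g q lam β

/-! ### Limit of the energy and of the objective values. -/

theorem objective_eq_value (S : Setting f g L m q rule lam β) {k : ℕ} (hk : g (xs k) ≠ ⊤) :
    objective f g (xs k) = ((Fs k : ℝ) : EReal) :=
  objective_eq_coe S.proper hk

theorem energy_ge (S : Setting f g L m q rule lam β) {k : ℕ} (hk : g (xs k) ≠ ⊤) :
    m / L ≤ Hs k := by
  have hL := S.L_pos
  have h := S.lower (xs k)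
  rw [S.objective_eq_value xi hk, EReal.coe_le_coe_iff] at h
  have h1 : m / L ≤ Fs k / L := by gcongr
  have h2 := one_le_weight S.q_zero k
  have h3 : 0 ≤ weight q k * ‖ys k - xs k‖ ^ 2 / 8 := by positivity
  unfold energy
  linarith

theorem energy_succ_add_le (S : Setting f g L m q rule lam β) {k : ℕ} (hk : g (xs k) ≠ ⊤) :
    Hs (k + 1) + (‖ys k - xs k‖ ^ 2 + ‖xs (k + 1) - xs k‖ ^ 2) / 64 ≤ Hs k := by
  obtain ⟨r, hr, hr1, h⟩ := S.energy_succ_le xi hk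
  have := energyDrop_ge (D := ‖ys k - xs k‖) (δ := ‖xs (k + 1) - xs k‖) hr hr1
  unfold energy
  linarith

theorem summable_sq (S : Setting f g L m q rule lam β) {K : ℕ} (hK : ∀ k, K ≤ k → g (xs k) ≠ ⊤) :
    Summable fun k => ‖ys k - xs k‖ ^ 2 + ‖xs (k + 1) - xs k‖ ^ 2 := by
  rw [← summable_nat_add_iff K]
  refine summable_of_sum_range_le (c := 64 * (Hs K - m / L)) (fun k => by positivity) fun n => ?_
  suffices h : Hs (n + K) + (∑ k ∈ Finset.range n, (‖ys (k + K) - xs (k + K)‖ ^ 2 +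
      ‖xs (k + K + 1) - xs (k + K)‖ ^ 2)) / 64 ≤ Hs K by
    linarith [S.energy_ge xi (hK (n + K) (by omega))]
  induction n with
  | zero => simp
  | succ n ih =>
    have := S.energy_succ_add_le xi (hK (n + K) (by omega))
    rw [Finset.sum_range_succ, show n + 1 + K = n + K + 1 by omega]
    linarith

theorem tendsto_norm_ySeq_sub (S : Setting f g L m q rule lam β) {K : ℕ}
    (hK : ∀ k, K ≤ k → g (xs k) ≠ ⊤) : Tendsto (fun k => ‖ys k - xs k‖) atTop (𝓝 0) := by
  have h := (S.summable_sq xi hK).of_nonneg_of_le (fun k => sq_nonneg ‖ys k - xs k‖)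
    (fun _ => le_add_of_nonneg_right (sq_nonneg _))
  have h1 := h.tendsto_atTop_zero.sqrt
  simpa [Real.sqrt_sq (norm_nonneg _)] using h1

theorem summable_sq_step (S : Setting f g L m q rule lam β) {K : ℕ}
    (hK : ∀ k, K ≤ k → g (xs k) ≠ ⊤) : Summable fun k => ‖xs (k + 1) - xs k‖ ^ 2 :=
  (S.summable_sq xi hK).of_nonneg_of_le (fun _ => sq_nonneg _)
    (fun _ => le_add_of_nonneg_left (sq_nonneg _))

theorem tendsto_lastStep (S : Setting f g L m q rule lam β) {K : ℕ}
    (hK : ∀ k, K ≤ k → g (xs k) ≠ ⊤) : Tendsto Ms atTop (𝓝 0) := by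
  have h1 := (S.summable_sq_step xi hK).tendsto_atTop_zero.sqrt
  simp only [Real.sqrt_sq (norm_nonneg _), Real.sqrt_zero] at h1
  have h2 := ((S.tendsto_norm_ySeq_sub xi hK).add h1).comp S.tendsto_lastEffective
  rwa [add_zero] at h2

/-- Since weights may be unbounded, D_k → 0 does not suffice. The increments are at most 2δ_k²,
which is summable, and restarts supply infinitely many zeros. -/
theorem tendsto_weight_mul_sq (S : Setting f g L m q rule lam β) {K : ℕ}
    (hK : ∀ k, K ≤ k → g (xs k) ≠ ⊤) :
    Tendsto (fun k => weight q k * ‖ys k - xs k‖ ^ 2) atTop (𝓝 0) := by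
  refine tendsto_zero_of_le_add (s := fun k => 2 * ‖xs (k + 1) - xs k‖ ^ 2) (fun k => ?_)
    (fun k => by positivity) ((S.summable_sq_step xi hK).mul_left 2) (fun k => ?_) ?_
  · have := one_le_weight S.q_zero k
    positivity
  · have h1 := S.weight_mul_sq_succ_le xi k
    have h2 : 0 ≤ (1 - momentum q (k + 1)) * ‖ys k - xs k‖ ^ 2 :=
      mul_nonneg (by linarith [S.momentum_le_one (k + 1)]) (sq_nonneg _)
    linarith
  · have hm := checkpoint_strictMono S.q_pos
    refine frequently_atTop.2 fun N => ⟨checkpoint q (N + 1), (Nat.le_succ N).trans hm.le_apply, ?_⟩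
    obtain ⟨j, hj⟩ : ∃ j, checkpoint q (N + 1) = j + 1 :=
      ⟨checkpoint q (N + 1) - 1, by have := hm.le_apply (x := N + 1); omega⟩
    rw [hj, (S.state_succ_of_checkpoint xi ⟨_, hj⟩).2]
    simp

/-- The energy decreases to the limit of the objective values. -/
theorem exists_tendsto_value (S : Setting f g L m q rule lam β) {K : ℕ}
    (hK : ∀ k, K ≤ k → g (xs k) ≠ ⊤) :
    ∃ Flim : ℝ, Tendsto Fs atTop (𝓝 Flim) ∧ ∀ k, K ≤ k → Flim / L ≤ Hs k := by
  have hL := S.L_pos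
  have hanti : Antitone fun n => Hs (n + K) := antitone_nat_of_succ_le fun n => by
    have h := S.energy_succ_add_le xi (hK (n + K) (by omega))
    have h0 : 0 ≤ (‖ys (n + K) - xs (n + K)‖ ^ 2 + ‖xs (n + K + 1) - xs (n + K)‖ ^ 2) / 64 := by
      positivity
    rw [show n + 1 + K = n + K + 1 by omega]
    linarith
  have hbdd : BddBelow (Set.range fun n => Hs (n + K)) :=
    ⟨m / L, by rintro _ ⟨n, rfl⟩; exact S.energy_ge xi (hK (n + K) (by omega))⟩
  have hlim := tendsto_atTop_ciInf hanti hbdd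
  rw [tendsto_add_atTop_iff_nat (f := Hs)] at hlim
  set h := ⨅ n, Hs (n + K)
  refine ⟨L * h, ?_, fun k hk => ?_⟩
  · have h1 := (hlim.sub ((S.tendsto_weight_mul_sq xi hK).div_const 8)).const_mul L
    simp only [zero_div, sub_zero] at h1
    refine h1.congr fun k => ?_
    unfold energy
    field_simp
    ring
  · rw [mul_div_cancel_left₀ _ hL.ne']
    obtain ⟨n, rfl⟩ := Nat.exists_eq_add_of_le' hk
    exact ciInf_le hbdd n

theorem value_le (S : Setting f g L m q rule lam β) {K : ℕ} (hK : ∀ k, K ≤ k → g (xs k) ≠ ⊤)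
    {k : ℕ} (hk : K ≤ k) : Fs k ≤ L * Hs K := by
  have hL := S.L_pos
  have h : Hs k ≤ Hs K := by
    induction k, hk using Nat.le_induction with
    | base => exact le_rfl
    | succ k hk ih =>
      have h := S.energy_succ_add_le xi (hK k hk)
      have h0 : 0 ≤ (‖ys k - xs k‖ ^ 2 + ‖xs (k + 1) - xs k‖ ^ 2) / 64 := by positivity
      linarith
  have hw := one_le_weight S.q_zero k
  have h2 : 0 ≤ weight q k * ‖ys k - xs k‖ ^ 2 / 8 := by positivity
  have h3 : Fs k / L ≤ Hs K := by unfold energy at h ⊢; linarith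
  rwa [div_le_iff₀' hL] at h3

theorem continuous_f (S : Setting f g L m q rule lam β) : Continuous f := S.diff.continuous

/-- The objective has the limit of the objective values as its value at every cluster point. -/
theorem objective_eq_of_clusterPt (S : Setting f g L m q rule lam β) {K : ℕ}
    (hK : ∀ k, K ≤ k → g (xs k) ≠ ⊤ ∧ xs k = xs (lastEffective rule q k + 1) ∧
      xs k = ps (lastEffective rule q k)) {Flim : ℝ} (hF : Tendsto Fs atTop (𝓝 Flim))
    {ω : Euc d} (hω : g ω ≠ ⊤) (hωx : MapClusterPt ω atTop xs) :
    objective f g ω = (Flim : EReal) := by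
  obtain ⟨ψ, hψ, hψx⟩ := hωx.tendsto_subseq
  have hψ' := hψ.tendsto_atTop
  have hG : Tendsto (fun n => (g (xs (ψ n))).toReal) atTop (𝓝 (Flim - f ω)) := by
    have h1 := (hF.comp hψ').sub ((S.continuous_f.tendsto ω).comp hψx)
    refine h1.congr fun n => ?_
    simp [value]
  rw [objective_eq_coe S.proper hω, EReal.coe_eq_coe_iff]
  have hge : ∀ᶠ n in atTop, K ≤ ψ n := hψ'.eventually_ge_atTop K
  refine le_antisymm ?_ ?_
  -- Lower semicontinuity gives this direction; the other one is the proximal comparison with ω.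
  · suffices h : (g ω).toReal ≤ Flim - f ω by linarith
    refine le_of_forall_lt_imp_le_of_dense fun r hr => ?_
    have hr' : (r : EReal) < g ω := by
      rw [← S.proper.coe_toReal hω]; exact_mod_cast hr
    refine ge_of_tendsto hG ?_
    filter_upwards [hψx.eventually (S.lsc ω r hr'), hge] with n hn hn'
    have : (r : EReal) < g (xs (ψ n)) := hn
    rw [← S.proper.coe_toReal (hK _ hn').1, EReal.coe_lt_coe_iff] at this
    exact this.le
  · have hM := (S.tendsto_lastStep xi fun k hk => (hK k hk).1).comp hψ'
    have hN : Tendsto (fun n => ‖ω - xs (ψ n)‖) atTop (𝓝 0) := by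
      have := (tendsto_const_nhds (x := ω)).sub hψx
      simpa using this.norm
    have hR := (((((hM.const_mul (9 * L)).add_const ‖∇ f ω‖).add (hN.const_mul L)).mul hN).const_add
      (g ω).toReal)
    have := le_of_tendsto_of_tendsto hG hR (by
      filter_upwards [hge] with n hn
      exact S.toReal_le_add xi (hK _ hn).2.1 (hK _ hn).2.2 hω)
    simp only [mul_zero, add_zero] at this
    linarith

/-- The iterates have finite length. -/
theorem summable_norm_sub (S : Setting f g L m q rule lam β)
    (hF_level : ∀ a : ℝ, IsCompact {u | objective f g u ≤ (a : EReal)})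
    (hF_KL : HasKL (objective f g)) {K : ℕ}
    (hK : ∀ k, K ≤ k → g (xs k) ≠ ⊤ ∧ xs k = xs (lastEffective rule q k + 1) ∧
      xs k = ps (lastEffective rule q k)) : Summable fun k => ‖xs (k + 1) - xs k‖ := by
  have hL := S.L_pos
  have hK1 : ∀ k, K ≤ k → g (xs k) ≠ ⊤ := fun k hk => (hK k hk).1
  obtain ⟨Flim, hF, hH⟩ := S.exists_tendsto_value xi hK1
  set C := {u | objective f g u ≤ ((L * Hs K : ℝ) : EReal)} with hCdef
  have hC : IsCompact C := hF_level _
  have hxC : ∀ᶠ k in atTop, xs k ∈ C := by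
    filter_upwards [eventually_ge_atTop K] with k hk
    rw [hCdef, Set.mem_ofPred_eq, S.objective_eq_value xi (hK1 k hk), EReal.coe_le_coe_iff]
    exact S.value_le xi hK1 hk
  -- KL is applied once, to the compact set of all cluster points, which the iterates approach.
  set Ω := {ω | MapClusterPt ω atTop xs} with hΩ
  have hΩC : Ω ⊆ C := fun ω hω => hC.isClosed.mem_of_mapClusterPt hω hxC
  have hΩcl : IsClosed Ω := isClosed_setOfPred_clusterPt
  have hΩc : IsCompact Ω := hC.of_isClosed_subset hΩcl hΩC
  have hΩF : ∀ ω ∈ Ω, objective f g ω = (Flim : EReal) := fun ω hω =>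
    S.objective_eq_of_clusterPt xi hK hF (objective_ne_top_iff.1 fun h => by
      have := hΩC hω
      rw [hCdef, Set.mem_ofPred_eq, h, top_le_iff] at this
      exact EReal.coe_ne_top _ this) hω
  obtain ⟨ε, hε, μ, hμ, c, hc, θ, ⟨hθ, -⟩, hKL⟩ := hF_KL Ω Flim hΩc hΩF
  have hFlt : ∀ᶠ k in atTop, Fs k < Flim + min μ 1 :=
    hF.eventually_lt_const (by linarith [lt_min hμ one_pos])
  obtain ⟨N, hN⟩ := eventually_atTop.1
    ((eventually_infEDist_clusterPts_lt hC hxC hε).and (hFlt.and (eventually_ge_atTop K)))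
  set θ' := min θ (1 / 2) with hθ'
  have hθ'0 : 0 < θ' := lt_min hθ (by norm_num)
  have hkl : ∀ k, N ≤ k → 0 < (Fs k - Flim) / L →
      ((Fs k - Flim) / L) ^ (1 - θ') ≤ (c * (9 * L) / L ^ (1 - θ')) * Ms k := by
    intro k hk hpos
    obtain ⟨h1, h2, h3⟩ := hN k hk
    have hs : 0 < Fs k - Flim := by
      have := mul_pos hpos hL; rwa [div_mul_cancel₀ _ hL.ne'] at this
    obtain ⟨u, hu, huN⟩ := S.exists_subgradient xi (hK k h3).2.1 (hK k h3).2.2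
    have hval := S.objective_eq_value xi (hK1 k h3)
    have h4 := hKL (xs k) h1 (by rw [hval]; exact_mod_cast (by linarith : Flim < Fs k))
      (by rw [hval]; exact_mod_cast h2.trans_le (by linarith [min_le_left μ 1]))
    rw [hval, EReal.toReal_coe] at h4
    have h5 := rpow_le_of_KL hc hθ hs (by linarith [min_le_right μ 1])
      (frechetSubdiff_subset_limitingSubdiff _ _ hu) huN h4
    rw [Real.div_rpow hs.le hL.le, div_mul_eq_mul_div]
    gcongr
    linarith
  have hstep : ∀ k, N ≤ k → ∃ r, 1 / 3 ≤ r ∧ r ≤ 1 ∧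
      (Fs (k + 1) - Flim) / L + weight q (k + 1) * ‖ys (k + 1) - xs (k + 1)‖ ^ 2 / 8 ≤
      (Fs k - Flim) / L + weight q k * ‖ys k - xs k‖ ^ 2 / 8 -
        energyDrop r ‖ys k - xs k‖ ‖xs (k + 1) - xs k‖ := fun k hk => by
    obtain ⟨r, hr, hr1, h⟩ := S.energy_succ_le xi (hK1 k (hN k hk).2.2)
    refine ⟨r, hr, hr1, ?_⟩
    rw [sub_div, sub_div]
    linarith
  have hmain := summable_of_energy_of_KL hθ'0 (min_le_right _ _)
    (show 0 < c * (9 * L) / L ^ (1 - θ') by positivity)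
    (w := fun n => weight q (N + n)) (D := fun n => ‖ys (N + n) - xs (N + n)‖)
    (δ := fun n => ‖xs (N + n + 1) - xs (N + n)‖) (F := fun n => (Fs (N + n) - Flim) / L)
    (M := fun n => Ms (N + n)) (fun n => one_le_weight S.q_zero _) (fun n => norm_nonneg _)
    (fun n => norm_nonneg _) (fun n => lastStep_nonneg xi _) (fun n => by
      have := hH (N + n) (hN (N + n) (by omega)).2.2
      unfold energy at this
      rw [sub_div]
      linarith) (fun n => hkl (N + n) (by omega)) (fun n => S.weight_succ_le (N + n))
    (fun n => S.weight_mul_norm_succ_le xi (N + n)) (fun n => hstep (N + n) (by omega))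
    (fun n => S.lastStep_succ xi (N + n))
  rw [← summable_nat_add_iff N]
  refine hmain.of_nonneg_of_le (fun n => norm_nonneg _) fun n => ?_
  rw [add_comm n N]
  exact le_add_of_nonneg_left (norm_nonneg _)

/-- The limit of the iterates is critical. -/
theorem mem_crit_of_tendsto (S : Setting f g L m q rule lam β)
    (hF_level : ∀ a : ℝ, IsCompact {u | objective f g u ≤ (a : EReal)}) {K : ℕ}
    (hK : ∀ k, K ≤ k → g (xs k) ≠ ⊤ ∧ xs k = xs (lastEffective rule q k + 1) ∧
      xs k = ps (lastEffective rule q k)) {xstar : Euc d} (hx : Tendsto xs atTop (𝓝 xstar)) :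
    xstar ∈ crit (objective f g) := by
  have hK1 : ∀ k, K ≤ k → g (xs k) ≠ ⊤ := fun k hk => (hK k hk).1
  obtain ⟨Flim, hF, -⟩ := S.exists_tendsto_value xi hK1
  have hlev : objective f g xstar ≤ ((L * Hs K : ℝ) : EReal) := by
    refine (hF_level _).isClosed.mem_of_tendsto hx ?_
    filter_upwards [eventually_ge_atTop K] with k hk
    rw [S.objective_eq_value xi (hK1 k hk), EReal.coe_le_coe_iff]
    exact S.value_le xi hK1 hk
  have htop : objective f g xstar ≠ ⊤ := fun h => by
    rw [h, top_le_iff] at hlev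
    exact EReal.coe_ne_top _ hlev
  have hval := S.objective_eq_of_clusterPt xi hK hF (objective_ne_top_iff.1 htop) hx.mapClusterPt
  choose! u hu huN using fun k (hk : K ≤ k) =>
    S.exists_subgradient xi (hK k hk).2.1 (hK k hk).2.2
  refine ⟨by rw [hval]; exact EReal.coe_ne_bot _, htop, fun n => xs (n + K), fun n => u (n + K),
    hx.comp (tendsto_add_atTop_nat K), ?_, fun n => hu _ (by omega), ?_⟩
  · rw [hval]
    have h1 : Tendsto (fun n => ((Fs (n + K) : ℝ) : EReal)) atTop (𝓝 (Flim : EReal)) :=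
      (continuous_coe_real_ereal.tendsto Flim).comp (hF.comp (tendsto_add_atTop_nat K))
    exact h1.congr fun n => (S.objective_eq_value xi (hK1 _ (by omega))).symm
  · have h1 := ((S.tendsto_lastStep xi hK1).const_mul (9 * L)).comp (tendsto_add_atTop_nat K)
    rw [mul_zero] at h1
    exact squeeze_zero_norm (fun n => huN _ (by omega)) h1

end Setting

end APGRestart

theorem mainTheorem3 (d : ℕ) (f : APGRestart.Euc d → ℝ) (g : APGRestart.Euc d → EReal) (L : ℝ)
    (hL : 0 < L)
    -- `f` is differentiable with `L`-Lipschitz gradient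
    (hf : Differentiable ℝ f)
    (hfL : ∀ u v : APGRestart.Euc d, ‖∇ f u - ∇ f v‖ ≤ L * ‖u - v‖)
    -- `g` is proper, convex and lower semicontinuous
    (hg_proper : APGRestart.IsProper g)
    (hg_convex : APGRestart.IsConvexFun g)
    (hg_lsc : LowerSemicontinuous g)
    -- `F = f + g` is bounded below, has compact level sets and the KL property
    (hF_bdd : ⊥ < ⨅ u, APGRestart.objective f g u)
    (hF_level : ∀ a : ℝ, IsCompact {u | APGRestart.objective f g u ≤ (a : EReal)})
    (hF_KL : APGRestart.HasKL (APGRestart.objective f g))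
    -- restart periods
    (q : ℕ → ℕ) (hq0 : q 0 = 0) (hq : ∀ t, 1 ≤ t → 1 ≤ q t)
    -- reset rule; under the rule `previous`, a period of length one leaves the iterate where it is
    (rule : APGRestart.ResetRule)
    (hrule : rule = APGRestart.ResetRule.previous → ∃ᶠ t in atTop, 2 ≤ q t)
    -- step sizes
    (lam β : ℕ → ℝ) (hβ : ∀ k, β k = 1 / (8 * L))
    (hlam : ∀ k, lam k ∈ Set.Icc (β k) ((1 + APGRestart.momentum q (k + 1)) * β k))
    (xinit : APGRestart.Euc d) :
    Summable (APGRestart.pathLength q (APGRestart.xSeq rule f g q lam β xinit)) ∧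
    ∃ xstar ∈ APGRestart.crit (APGRestart.objective f g),
      Tendsto (APGRestart.xSeq rule f g q lam β xinit) atTop (𝓝 xstar) ∧
      Tendsto (APGRestart.ySeq rule f g q lam β xinit) atTop (𝓝 xstar) ∧
      Tendsto (APGRestart.zSeq rule f g q lam β xinit) atTop (𝓝 xstar) := by
  obtain ⟨m, -, hm⟩ := EReal.lt_iff_exists_real_btwn.1 hF_bdd
  have S : APGRestart.Setting f g L m q rule lam β :=
    ⟨hL, hf, hfL, hg_proper, hg_convex, hg_lsc, fun u => hm.le.trans (iInf_le _ u), hq0, hq, hrule,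
      hβ, hlam⟩
  obtain ⟨K, hK⟩ := S.exists_forall_eq_proxPoint xinit
  have hsum := S.summable_norm_sub xinit hF_level hF_KL hK
  obtain ⟨xstar, hx⟩ := cauchySeq_tendsto_of_complete
    (cauchySeq_of_summable_dist (f := APGRestart.xSeq rule f g q lam β xinit)
      (hsum.congr fun k => by rw [dist_comm, dist_eq_norm]))
  have hyx := S.tendsto_norm_ySeq_sub xinit fun k hk => (hK k hk).1
  have hzx := squeeze_zero (fun k => norm_nonneg _) (S.norm_zSeq_sub_le xinit) hyx
  refine ⟨APGRestart.summable_pathLength hq0 hq hsum, xstar,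
    S.mem_crit_of_tendsto xinit hF_level hK hx, hx, ?_, ?_⟩
  · simpa using hx.add (tendsto_zero_iff_norm_tendsto_zero.2 hyx)
  · simpa using hx.add (tendsto_zero_iff_norm_tendsto_zero.2 hzx)
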